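/- Let $h_0>0$, $n\in\mathbb N$, let $\|\cdot\|$ be an algebra norm on $M_n(\mathbb C)$ and $|||\cdot|||$ the subordinate norm on the space of endomorphisms of $M_n(\mathbb C)$. For $h>0$ put $\delta_{-h}y(x)=(x-h)\,\frac{y(x)-y(x-h)}{h}$, $x^{[s]_h}=x(x+h)\cdots(x+(s-1)h)$ and $x^{-[s]_h}=1/x^{[s]_h}$. Let $\mathcal O_{fact}^{(h)}$ be the ring of sums of $h$-factorial series $\sum_{s\ge 0}a_s x^{-[s]_h}$ that converge in some right half-plane (two functions being identified if they agree on some right half-plane). An element $\sum_{s\ge0} A_sx^{-[s]_h}$ of $M_n(\mathcal O_{fact}^{(h)})$ takes the value $A_0$ at $+\infty$. For $C,\lambda\ge 0$, a family $A^{(h)}=\sum_{s\ge 0}A^{(h)}_s x^{-[s]_h}\in M_n(\mathcal O_{fact}^{(h)})$, $h\in\,]0,h_0[$, is of type $(C,\lambda)$ if there is $h_0'\in\,]0,h_0[$ such that $\|A^{(h)}_s\|\le C\lambda^{[s-1]_h}$ for all $h\in\,]0,h_0'[$ and all $s\ge 1$, and if $\|A^{(h)}_0\|$, $h\in\,]0,h_0[$,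 is bounded. In that case the family of systems $\delta_{-h}Y=A^{(h)}Y$ is called Fuchsian $(C,\lambda)$ at $+\infty$; it is non-resonant if, for every $h\in\,]0,h_0[$, no two eigenvalues of $A^{(h)}_0=A^{(h)}(+\infty)$ differ by a non-zero integer. For $F\in GL_n(\mathcal O_{fact}^{(h)})$, the change of unknown $Y\leftarrow FY$ turns $\delta_{-h}Y=AY$ into $\delta_{-h}Y=A^FY$, where $$A^F(x)=\frac{x-h}{h}\Bigl(I-F(x-h)^{-1}\bigl(I-\tfrac{h}{x-h}A(x)\bigr)F(x)\Bigr).$$ For $s\ge1$ let $K_{s,A_0^{(h)}}(M)=A_0^{(h)}M-MA_0^{(h)}-sM$, $M\in M_n(\mathbb C)$ (an invertible operator in the non-resonant case). **Theorem.** Let $\delta_{-h}Y=A^{(h)}Y$, $h\in\,]0,h_0[$, be a non-resonant family of Fuchsian $(C,\lambda)$ systems at $+\infty$ such that $$\sup_{s\ge 1,\ h\in]0,h_0[}|||K_{s,A_0^{(h)}}^{-1}|||<\infty .$$ Then for every $h\in\,]0,h_0[$ there is a unique $F^{(h)}\in GL_n(\mathcal O_{fact}^{(h)})$ such that $F^{(h)}(+\infty)=I$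 and $(A^{(h)})^{F^{(h)}}=A_0^{(h)}$. Moreover, the family $F^{(h)}$, $h\in\,]0,h_0[$, is of type $(C',\lambda')$ for some $C',\lambda'\ge0$. -/

import Mathlib

open Filter Topology Set

noncomputable section

namespace FuchsConfluence

/-- Square complex matrices of size `n`. -/
abbrev Mat (n : ℕ) : Type := Matrix (Fin n) (Fin n) ℂ

/-- The filter generated by the right half-planes `{x | σ < Re x}`, `σ → +∞`. Two functions that
agree along it are the same function near `+∞`. -/
def rightEnd : Filter ℂ := comap Complex.re atTop

/-- `x^{-[s]_h} = 1 / (x (x + h) ⋯ (x + (s - 1) h))`. -/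
def invFactorial (h : ℝ) (s : ℕ) (x : ℂ) : ℂ :=
  (∏ k ∈ Finset.range s, (x + (k : ℂ) * (h : ℂ)))⁻¹

/-- `r^{[s]_h} = r (r + h) ⋯ (r + (s - 1) h)` for a real number `r`. -/
def risingFactorial (h : ℝ) (s : ℕ) (r : ℝ) : ℝ :=
  ∏ k ∈ Finset.range s, (r + (k : ℝ) * h)

/-- In some right half-plane the `h`-factorial series `∑ₛ aₛ x^{-[s]_h}` converges, with
sum `F x`. -/
def HasFactorialExpansion {n : ℕ} (h : ℝ) (F : ℂ → Mat n) (a : ℕ → Mat n) : Prop :=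
  ∀ᶠ x in rightEnd,
    Tendsto (fun m : ℕ => ∑ s ∈ Finset.range m, invFactorial h s x • a s) atTop (𝓝 (F x))

/-- `F ∈ M_n(O_fact^{(h)})`: `F` is the sum of a convergent `h`-factorial series. -/
def IsFactorial {n : ℕ} (h : ℝ) (F : ℂ → Mat n) : Prop :=
  ∃ a : ℕ → Mat n, HasFactorialExpansion h F a

/-- `F ∈ GL_n(O_fact^{(h)})`: `F` is an invertible element of the ring `M_n(O_fact^{(h)})`. -/
def IsFactorialGL {n : ℕ} (h : ℝ) (F : ℂ → Mat n) : Prop :=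
  IsFactorial h F ∧
    ∃ G : ℂ → Mat n, IsFactorial h G ∧ ∀ᶠ x in rightEnd, F x * G x = 1 ∧ G x * F x = 1

/-- `F(+∞) = M`. -/
def HasValueAtInfty {n : ℕ} (F : ℂ → Mat n) (M : Mat n) : Prop :=
  Tendsto F rightEnd (𝓝 M)

/-- The family `A h`, `0 < h < h₀`, of sums of convergent `h`-factorial series is of type
`(C, lam)`, with respect to the norm `N`. -/
def IsOfType {n : ℕ} (N : AlgebraNorm ℂ (Mat n)) (h₀ C lam : ℝ) (A : ℝ → ℂ → Mat n) : Prop :=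
  0 ≤ C ∧ 0 ≤ lam ∧
    ∃ a : ℝ → ℕ → Mat n,
      (∀ h ∈ Ioo 0 h₀, HasFactorialExpansion h (A h) (a h)) ∧
      (∃ h₁ ∈ Ioo 0 h₀, ∀ h ∈ Ioo 0 h₁, ∀ s : ℕ, 1 ≤ s →
        N (a h s) ≤ C * risingFactorial h (s - 1) lam) ∧
      ∃ B : ℝ, ∀ h ∈ Ioo 0 h₀, N (a h 0) ≤ B

/-- The family of systems `δ_{-h} Y = A h Y`, `0 < h < h₀`, is Fuchsian `(C, lam)` at `+∞`. -/
def IsFuchsian {n : ℕ} (N : AlgebraNorm ℂ (Mat n)) (h₀ C lam : ℝ) (A : ℝ → ℂ → Mat n) : Prop :=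
  (∀ h ∈ Ioo 0 h₀, IsFactorial h (A h)) ∧ IsOfType N h₀ C lam A

/-- Two eigenvalues of `M` never differ by a non-zero integer. -/
def IsNonResonant {n : ℕ} (M : Mat n) : Prop :=
  ∀ μ ∈ spectrum ℂ M, ∀ ν ∈ spectrum ℂ M, ∀ m : ℤ, m ≠ 0 → μ - ν ≠ (m : ℂ)

/-- The operator `M ↦ A₀ M - M A₀ - s M`. -/
def opK {n : ℕ} (s : ℕ) (A₀ : Mat n) : Module.End ℂ (Mat n) :=
  LinearMap.mulLeft ℂ A₀ - LinearMap.mulRight ℂ A₀ - (s : ℂ) • (1 : Module.End ℂ (Mat n))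

/-- The norm on the endomorphisms of `M_n(ℂ)` subordinate to `N`. -/
def subordNorm {n : ℕ} (N : AlgebraNorm ℂ (Mat n)) (T : Module.End ℂ (Mat n)) : ENNReal :=
  ⨆ M ∈ {M : Mat n | N M ≤ 1}, ENNReal.ofReal (N (T M))

/-- The matrix `A^F` of the system satisfied by `Z` when `Y = F Z` and
`δ_{-h} Y = A Y`, where `δ_{-h} Y (x) = (x - h) (Y x - Y (x - h)) / h`, that is, when
`Y (x - h) = (1 - h / (x - h) A x) Y x`. -/
def gaugeTransform {n : ℕ} (h : ℝ) (A F : ℂ → Mat n) (x : ℂ) : Mat n :=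
  ((x - (h : ℂ)) / (h : ℂ)) •
    (1 - (F (x - (h : ℂ)))⁻¹ * (1 - ((h : ℂ) / (x - (h : ℂ))) • A x) * F x)

/-- `F` is a gauge transformation in `GL_n(O_fact^{(h)})` with `F(+∞) = 1` and `A^F = A₀`. -/
def IsNormalizingGauge {n : ℕ} (h : ℝ) (A : ℂ → Mat n) (A₀ : Mat n) (F : ℂ → Mat n) : Prop :=
  IsFactorialGL h F ∧ HasValueAtInfty F 1 ∧ ∀ᶠ x in rightEnd, gaugeTransform h A F x = A₀

end FuchsConfluence

end

noncomputable section

namespace FuchsConfluence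

section RisingFactorials

/-! ### Rising factorials -/

/-! Clearing the inverse, `A^F = A₀` becomes `A(x) F(x) - F(x-h) A₀ + ((x-h)/h) (F(x-h) - F(x)) =
0`. Since `x^{-[s]_h}` is an eigenfunction of `δ_{-h}` with eigenvalue `-s` (`invFactorial_sub`),
the coefficients `f_s` of `F` satisfy `A₀ f_s - f_s A₀ + s f_s =` an expression in the `f_j`, `j <
s` (`gaugeSeries`). Once the operator on the left is invertible, `f_0 = 1` determines the series,
and uniqueness of factorial expansions (`AbsConv.eq_zero`) makes the gauge unique.

The main point is convergence, uniformly in `h`. Series are measured by `absSum`, a weighted `ℓ¹`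
norm at a real point `r`. Products of inverse factorials expand with nonnegative coefficients, so
this norm is submultiplicative (`AbsConv.mul_series`), and the tail of `A` has norm at most `C / (r
- λ)`. The term `F(x-h) A₀` brings a small factor `h / (r - h)` but loses a factor `s` at index `s`
(`exists_diffSeries_bound`); the inverse of the left-hand operator gains `1/s`
(`mul_norm_le_of_bound`). For `r` large, independently of small `h`, the recursion therefore has
linear part of norm at most `1/2`, and a truncation argument (`AbsConv.of_causal_fixedPoint`) bounds
`absSum` of `f`. Each single term then gives `‖f_s‖ ≤ const · r^{[s]_h}`.

The hypothesis bounds the inverse of `ad A₀ - s`, whereas the recursion inverts `ad A₀ + s`. Up to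
sign these are transposes for the trace pairing (`exists_le_opK_bound`). -/

lemma risingFactorial_zero (h r : ℝ) : risingFactorial h 0 r = 1 := by
  simp [risingFactorial]

lemma risingFactorial_succ (h r : ℝ) (s : ℕ) :
    risingFactorial h (s + 1) r = risingFactorial h s r * (r + s * h) := by
  simp [risingFactorial, Finset.prod_range_succ]

lemma risingFactorial_succ' (h r : ℝ) (s : ℕ) :
    risingFactorial h (s + 1) r = r * risingFactorial h s (r + h) := by
  simp only [risingFactorial, Finset.prod_range_succ']
  rw [mul_comm]
  simp only [Nat.cast_zero, zero_mul, add_zero]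
  congr 1
  refine Finset.prod_congr rfl fun k _ => ?_
  push_cast; ring

lemma risingFactorial_pos {h r : ℝ} (hh : 0 ≤ h) (hr : 0 < r) (s : ℕ) :
    0 < risingFactorial h s r :=
  Finset.prod_pos fun _ _ => by positivity

lemma risingFactorial_nonneg {h r : ℝ} (hh : 0 ≤ h) (hr : 0 ≤ r) (s : ℕ) :
    0 ≤ risingFactorial h s r :=
  Finset.prod_nonneg fun _ _ => by positivity

lemma risingFactorial_mono {h r r' : ℝ} (hh : 0 ≤ h) (hr : 0 ≤ r) (hr' : r ≤ r') (s : ℕ) :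
    risingFactorial h s r ≤ risingFactorial h s r' :=
  Finset.prod_le_prod (fun _ _ => by positivity) fun _ _ => by linarith

lemma invFactorial_zero (h : ℝ) (x : ℂ) : invFactorial h 0 x = 1 := by
  simp [invFactorial]

lemma invFactorial_succ (h : ℝ) (s : ℕ) (x : ℂ) :
    invFactorial h (s + 1) x = invFactorial h s x / (x + s * h) := by
  simp [invFactorial, Finset.prod_range_succ, mul_comm, div_eq_mul_inv]

lemma invFactorial_succ' (h : ℝ) (s : ℕ) (x : ℂ) :
    invFactorial h (s + 1) x = invFactorial h s (x + h) / x := by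
  simp only [invFactorial, Finset.prod_range_succ', Nat.cast_zero, zero_mul, add_zero, mul_inv,
    div_eq_mul_inv]
  congr 2
  refine Finset.prod_congr rfl fun k _ => ?_
  push_cast; ring

lemma invFactorial_ofReal (h : ℝ) (s : ℕ) (r : ℝ) :
    invFactorial h s (r : ℂ) = (((risingFactorial h s r)⁻¹ : ℝ) : ℂ) := by
  simp [invFactorial, risingFactorial]

lemma add_natCast_mul_ne_zero {h : ℝ} (hh : 0 ≤ h) {x : ℂ} (hx : 0 < x.re) (k : ℕ) :
    x + k * h ≠ 0 := by
  intro h0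
  have := congrArg Complex.re h0
  simp at this
  have : 0 ≤ (k : ℝ) * h := by positivity
  linarith

lemma norm_invFactorial_le {h r : ℝ} (hh : 0 ≤ h) (hr : 0 < r) {x : ℂ} (hx : r ≤ x.re) (s : ℕ) :
    ‖invFactorial h s x‖ ≤ (risingFactorial h s r)⁻¹ := by
  rw [invFactorial, norm_inv, norm_prod]
  refine inv_anti₀ (risingFactorial_pos hh hr s) ?_
  refine Finset.prod_le_prod (fun _ _ => by positivity) fun k _ => ?_
  refine le_trans ?_ (Complex.re_le_norm _)
  simp
  exact hx

lemma invFactorial_sub {h : ℝ} (hh : 0 < h) {x : ℂ} (hx : h < x.re) (s : ℕ) :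
    invFactorial h s (x - h) - invFactorial h s x = h * s / (x - h) * invFactorial h s x := by
  have hx0 : ∀ k : ℕ, x - h + k * h ≠ 0 :=
    add_natCast_mul_ne_zero hh.le (by simpa using hx)
  have key : invFactorial h s (x - h) * (x - h) = invFactorial h s x * (x - h + s * h) := by
    have h1 := invFactorial_succ h s (x - h)
    have h2 := invFactorial_succ' h s (x - h)
    rw [h1, sub_add_cancel] at h2
    have h3 := hx0 0
    simp only [Nat.cast_zero, zero_mul, add_zero] at h3
    rw [div_eq_div_iff (hx0 s) h3] at h2
    exact h2
  have h3 := hx0 0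
  simp only [Nat.cast_zero, zero_mul, add_zero] at h3
  field_simp
  linear_combination key

/-! ### The expansion of `x^{-[m]_h} / (x + τ)` -/

/-- The ratio decreases, with drops `(m - l) u_j / (m + j h)` of bounded sum; a positive limit would
make the harmonic series converge. -/
lemma tendsto_risingFactorial_div {h l m : ℝ} (hh : 0 < h) (hl : 0 ≤ l) (hlm : l < m) :
    Tendsto (fun j => risingFactorial h j l / risingFactorial h j m) atTop (𝓝 0) := by
  have hm : 0 < m := hl.trans_lt hlm
  set u : ℕ → ℝ := fun j => risingFactorial h j l / risingFactorial h j m with hu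
  have hu0 : ∀ j, 0 ≤ u j := fun j =>
    div_nonneg (risingFactorial_nonneg hh.le hl j) (risingFactorial_pos hh.le hm j).le
  have hden : ∀ j : ℕ, 0 < m + j * h := fun j => by positivity
  have husucc : ∀ j, u (j + 1) = u j - (m - l) * (u j / (m + j * h)) := fun j => by
    have := (hden j).ne'
    have h2 := (risingFactorial_pos hh.le hm j).ne'
    simp only [hu, risingFactorial_succ]
    field_simp
    ring
  have hpart : ∀ J, ∑ j ∈ Finset.range J, (m - l) * (u j / (m + j * h)) = 1 - u J := fun J => by
    induction J with
    | zero => simp [hu, risingFactorial_zero]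
    | succ J ih => rw [Finset.sum_range_succ, ih, husucc]; ring
  have hterm : ∀ j : ℕ, 0 ≤ (m - l) * (u j / (m + j * h)) := fun j =>
    mul_nonneg (by linarith) (div_nonneg (hu0 j) (hden j).le)
  have hsum : Summable fun j : ℕ => (m - l) * (u j / (m + j * h)) :=
    summable_of_sum_range_le (c := 1) hterm fun J => by rw [hpart J]; linarith [hu0 J]
  have hanti : Antitone u := antitone_nat_of_succ_le fun j => by
    rw [husucc]; linarith [hterm j]
  have hbdd : BddBelow (range u) := ⟨0, by rintro _ ⟨j, rfl⟩; exact hu0 j⟩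
  have hlim := tendsto_atTop_ciInf hanti hbdd
  have hc0 : 0 ≤ ⨅ j, u j := le_ciInf hu0
  rcases hc0.eq_or_lt with hc | hc
  · rwa [← hc] at hlim
  · exfalso
    set c := ⨅ j, u j
    have h1 : Summable fun j : ℕ => (m - l) * (c / h) * (1 / |(j : ℝ) + m / h| ^ (1 : ℝ)) := by
      refine Summable.of_nonneg_of_le (fun j => ?_) (fun j => ?_) hsum
      · have : 0 ≤ m - l := by linarith
        positivity
      · have hj : 0 < (j : ℝ) + m / h := by positivity
        rw [Real.rpow_one, abs_of_pos hj, mul_assoc]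
        refine mul_le_mul_of_nonneg_left ?_ (by linarith)
        have : c / h * (1 / ((j : ℝ) + m / h)) = c / (m + j * h) := by
          have := (hden j).ne'
          field_simp
          rw [add_comm]
        rw [this]
        exact div_le_div_of_nonneg_right (ciInf_le hbdd j) (hden j).le
    have hne : (m - l) * (c / h) ≠ 0 := by
      have : 0 < m - l := by linarith
      positivity
    rw [summable_mul_left_iff hne, Real.summable_one_div_nat_add_rpow] at h1
    exact lt_irrefl _ h1

/-- Telescoping: each term is the difference of two consecutive remainders `(m h - τ)^{[j]}
x^{-[m+j]} / (x + τ)`. -/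
lemma sum_invFactorial_expansion {h τ : ℝ} (hh : 0 < h) (m : ℕ) {x : ℂ} (hx : 0 < x.re)
    (hτx : 0 < x.re + τ) (J : ℕ) :
    ∑ j ∈ Finset.range J, (risingFactorial h j (m * h - τ) : ℂ) * invFactorial h (m + j + 1) x
      = invFactorial h m x / (x + τ)
        - risingFactorial h J (m * h - τ) * invFactorial h (m + J) x / (x + τ) := by
  have hxτ : x + τ ≠ 0 := fun h0 => by
    have := congrArg Complex.re h0
    simp at this
    linarith
  induction J with
  | zero => simp [risingFactorial_zero]
  | succ J ih =>
    have h1 := add_natCast_mul_ne_zero hh.le hx (m + J)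
    rw [Finset.sum_range_succ, ih, risingFactorial_succ, ← add_assoc, invFactorial_succ]
    push_cast at h1 ⊢
    field_simp
    ring

lemma risingFactorial_add (h r : ℝ) (m j : ℕ) :
    risingFactorial h (m + j) r = risingFactorial h m r * risingFactorial h j (r + m * h) := by
  rw [risingFactorial, Finset.prod_range_add]
  congr 1
  refine Finset.prod_congr rfl fun k _ => ?_
  push_cast; ring

lemma summable_invFactorial_expansion {h τ r : ℝ} (hh : 0 < h) {m : ℕ} (hτ : τ ≤ m * h)
    (hr : 0 < r) (hτr : 0 < r + τ) :
    Summable fun j => risingFactorial h j (m * h - τ) * (risingFactorial h (m + j + 1) r)⁻¹ := by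
  have hnn : ∀ j, 0 ≤ risingFactorial h j (m * h - τ) := fun j =>
    risingFactorial_nonneg hh.le (by linarith) j
  refine summable_of_sum_range_le (c := (risingFactorial h m r)⁻¹ / (r + τ)) (fun j => ?_)
    fun J => ?_
  · exact mul_nonneg (hnn j) (inv_nonneg.2 (risingFactorial_pos hh.le hr _).le)
  · have := sum_invFactorial_expansion (τ := τ) hh m (x := (r : ℂ)) (by simpa) (by simpa) J
    simp only [invFactorial_ofReal] at this
    norm_cast at this
    rw [this]
    have : 0 ≤ risingFactorial h J (m * h - τ) * (risingFactorial h (m + J) r)⁻¹ / (r + τ) :=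
      div_nonneg (mul_nonneg (hnn J) (inv_nonneg.2 (risingFactorial_pos hh.le hr _).le)) hτr.le
    linarith

lemma hasSum_invFactorial_expansion {h τ : ℝ} (hh : 0 < h) {m : ℕ} (hτ : τ ≤ m * h) {x : ℂ}
    (hx : 0 < x.re) (hτx : 0 < x.re + τ) :
    HasSum (fun j => (risingFactorial h j (m * h - τ) : ℂ) * invFactorial h (m + j + 1) x)
      (invFactorial h m x / (x + τ)) := by
  have hl : 0 ≤ m * h - τ := by linarith
  have hnn : ∀ j, 0 ≤ risingFactorial h j (m * h - τ) := fun j => risingFactorial_nonneg hh.le hl j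
  have hsum : Summable fun j =>
      (risingFactorial h j (m * h - τ) : ℂ) * invFactorial h (m + j + 1) x := by
    refine Summable.of_norm_bounded (summable_invFactorial_expansion hh hτ hx hτx) fun j => ?_
    rw [norm_mul, Complex.norm_real, Real.norm_of_nonneg (hnn j)]
    exact mul_le_mul_of_nonneg_left (norm_invFactorial_le hh.le hx le_rfl _) (hnn j)
  rw [hsum.hasSum_iff_tendsto_nat]
  simp_rw [sum_invFactorial_expansion hh m hx hτx]
  rw [← tendsto_sub_nhds_zero_iff]
  -- The remainder vanishes in the limit because `m h - τ < Re x + m h`, which is `hτx`.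
  have hlim : Tendsto (fun J => risingFactorial h J (m * h - τ) / risingFactorial h J (x.re + m * h)
      * ((risingFactorial h m x.re)⁻¹ * ‖(x + τ)⁻¹‖)) atTop (𝓝 0) := by
    simpa using (tendsto_risingFactorial_div hh hl (m := x.re + m * h)
      (by linarith)).mul_const ((risingFactorial h m x.re)⁻¹ * ‖(x + τ)⁻¹‖)
  refine squeeze_zero_norm (fun J => ?_) hlim
  rw [sub_sub_cancel_left, norm_neg, div_eq_mul_inv _ (x + (τ : ℂ)), norm_mul, norm_mul,
    Complex.norm_real, Real.norm_of_nonneg (hnn J), div_eq_mul_inv, ← mul_assoc]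
  refine mul_le_mul_of_nonneg_right ?_ (norm_nonneg _)
  rw [mul_assoc]
  refine mul_le_mul_of_nonneg_left ((norm_invFactorial_le hh.le hx le_rfl _).trans ?_) (hnn J)
  rw [risingFactorial_add, mul_inv, mul_comm]

/-! ### Rearrangement of double series -/

/-- Tonelli for the nonnegative double series `c i m * w m * v i`. -/
lemma hasSum_kernel_real {ι : Type*} {c : ι → ℕ → ℝ} {w : ℕ → ℝ} {Φ v : ι → ℝ} {b : ℕ → ℝ} {S : ℝ}
    (hc : ∀ i m, 0 ≤ c i m) (hw : ∀ m, 0 ≤ w m) (hv : ∀ i, 0 ≤ v i)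
    (hΦ : ∀ i, HasSum (fun m => c i m * w m) (Φ i)) (hS : HasSum (fun i => Φ i * v i) S)
    (hb : ∀ m, HasSum (fun i => c i m * v i) (b m)) :
    HasSum (fun m => w m * b m) S := by
  have hs : Summable fun p : ι × ℕ => c p.1 p.2 * w p.2 * v p.1 := by
    rw [summable_prod_of_nonneg fun p => mul_nonneg (mul_nonneg (hc _ _) (hw _)) (hv _)]
    refine ⟨fun i => ((hΦ i).mul_right (v i)).summable, ?_⟩
    refine hS.summable.congr fun i => ?_
    exact (((hΦ i).mul_right (v i)).tsum_eq).symm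
  have h1 : HasSum (fun p : ι × ℕ => c p.1 p.2 * w p.2 * v p.1) S := by
    have := hs.hasSum.prod_fiberwise fun i => (hΦ i).mul_right (v i)
    rw [hS.unique this]
    exact hs.hasSum
  have h2 := (Equiv.prodComm ℕ ι).hasSum_iff.2 h1
  refine h2.prod_fiberwise fun m => ?_
  have h3 : ∀ i, w m * (c i m * v i) = c i m * w m * v i := fun i => by ring
  have h4 := (hb m).mul_left (w m)
  simp only [h3] at h4
  exact h4

variable {R : Type*} [NormedRing R] [NormedAlgebra ℂ R] [CompleteSpace R]

/-- Fubini, dominated by the positive double series with `w m` for `e m` and `‖a i‖` for `a i`. In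
use, `e m` is an inverse factorial at `x` and `w m` its value at a real point `r ≤ Re x`. -/
lemma hasSum_kernel {ι : Type*} {c : ι → ℕ → ℝ} {w : ℕ → ℝ} {e : ℕ → ℂ} {Φ : ι → ℝ} {φ : ι → ℂ}
    {a : ι → R} {b : ℕ → R} {A : R}
    (hc : ∀ i m, 0 ≤ c i m) (hw : ∀ m, 0 ≤ w m) (he : ∀ m, ‖e m‖ ≤ w m)
    (hΦ : ∀ i, HasSum (fun m => c i m * w m) (Φ i))
    (hφ : ∀ i, HasSum (fun m => (c i m : ℂ) * e m) (φ i))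
    (hS : Summable fun i => Φ i * ‖a i‖) (hA : HasSum (fun i => φ i • a i) A)
    (hb : ∀ m, HasSum (fun i => (c i m : ℂ) • a i) (b m)) :
    HasSum (fun m => e m • b m) A := by
  have hs : Summable fun p : ι × ℕ => c p.1 p.2 * w p.2 * ‖a p.1‖ := by
    rw [summable_prod_of_nonneg fun p => mul_nonneg (mul_nonneg (hc _ _) (hw _)) (norm_nonneg _)]
    refine ⟨fun i => ((hΦ i).mul_right ‖a i‖).summable, ?_⟩
    refine hS.congr fun i => ?_
    exact (((hΦ i).mul_right ‖a i‖).tsum_eq).symm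
  have hs' : Summable fun p : ι × ℕ => ((c p.1 p.2 : ℂ) * e p.2) • a p.1 := by
    refine Summable.of_norm_bounded hs fun p => ?_
    rw [norm_smul, norm_mul, Complex.norm_real, Real.norm_of_nonneg (hc _ _)]
    gcongr
    · exact hc _ _
    · exact he _
  have h1 : HasSum (fun p : ι × ℕ => ((c p.1 p.2 : ℂ) * e p.2) • a p.1) A := by
    have := hs'.hasSum.prod_fiberwise fun i => (hφ i).smul_const (a i)
    rw [hA.unique this]
    exact hs'.hasSum
  have h2 := (Equiv.prodComm ℕ ι).hasSum_iff.2 h1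
  refine h2.prod_fiberwise fun m => ?_
  convert (hb m).const_smul (e m) using 2
  simp only [Function.comp, Equiv.prodComm_apply, Prod.swap]
  rw [mul_comm, mul_smul]

end RisingFactorials

/-! ### Expansions of quotients and products of inverse factorials -/

section Products

lemma hasSum_of_eq {ι E : Type*} [AddCommMonoid E] [TopologicalSpace E] {f g : ι → E} {S : E}
    (hf : HasSum f S) (hfg : ∀ i, f i = g i) : HasSum g S :=
  funext hfg ▸ hf

lemma hasSum_ite_lt {E : Type*} [AddCommMonoid E] [TopologicalSpace E] {g : ℕ → E} {m : ℕ} {S : E}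
    (hg : HasSum (fun j => g (m + j + 1)) S) : HasSum (fun p => if m < p then g p else 0) S := by
  have hinj : Function.Injective fun j => m + j + 1 := fun i j hij => by
    simp only at hij; omega
  refine (hinj.hasSum_iff fun p hp => ?_).1 ?_
  · refine if_neg fun hlt => hp ⟨p - m - 1, ?_⟩
    simp only; omega
  · convert hg using 2 with j
    simp only [Function.comp]
    rw [if_pos (by omega)]

/-- The coefficients of the expansion of `x^{-[m]_h} / (x + τ)`. -/
def shiftCoeff (h τ : ℝ) (m p : ℕ) : ℝ :=
  if m < p then risingFactorial h (p - m - 1) (m * h - τ) else 0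

lemma shiftCoeff_nonneg {h τ : ℝ} (hh : 0 ≤ h) {m : ℕ} (hτ : τ ≤ m * h) (p : ℕ) :
    0 ≤ shiftCoeff h τ m p := by
  unfold shiftCoeff
  split_ifs
  · exact risingFactorial_nonneg hh (by linarith) _
  · exact le_rfl

lemma shiftCoeff_of_le {h τ : ℝ} {m p : ℕ} (hp : p ≤ m) : shiftCoeff h τ m p = 0 :=
  if_neg (by omega)

lemma hasSum_shiftCoeff {h τ : ℝ} (hh : 0 < h) {m : ℕ} (hτ : τ ≤ m * h) {x : ℂ}
    (hx : 0 < x.re) (hτx : 0 < x.re + τ) :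
    HasSum (fun p => (shiftCoeff h τ m p : ℂ) * invFactorial h p x)
      (invFactorial h m x / (x + τ)) := by
  have := hasSum_ite_lt (m := m) (S := invFactorial h m x / (x + τ))
    (g := fun p => (risingFactorial h (p - m - 1) (m * h - τ) : ℂ) * invFactorial h p x) (by
      convert hasSum_invFactorial_expansion hh hτ hx hτx using 4 with j
      congr 1; omega)
  convert this using 2 with p
  unfold shiftCoeff
  split_ifs <;> simp

lemma hasSum_shiftCoeff_real {h τ r : ℝ} (hh : 0 < h) {m : ℕ} (hτ : τ ≤ m * h)
    (hr : 0 < r) (hτr : 0 < r + τ) :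
    HasSum (fun p => shiftCoeff h τ m p * (risingFactorial h p r)⁻¹)
      ((risingFactorial h m r)⁻¹ / (r + τ)) := by
  have := hasSum_shiftCoeff (τ := τ) hh hτ (x := (r : ℂ)) (by simpa) (by simpa)
  simp only [invFactorial_ofReal] at this
  exact_mod_cast this

/-! ### Product of factorial series -/

/-- The coefficients of the expansion of `x^{-[s]_h} x^{-[t]_h}`. -/
def mulCoeff (h : ℝ) (s : ℕ) : ℕ → ℕ → ℝ
  | 0, p => if p = s then 1 else 0
  | t + 1, p => ∑ m ∈ Finset.range p, shiftCoeff h (t * h) m p * mulCoeff h s t m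

/-- Orders add under multiplication. Hence the finite sum in `mulSeries` omits nothing, and
multiplication by a series without constant term is strictly triangular. -/
lemma mulCoeff_eq_zero (h : ℝ) {s t p : ℕ} (hp : p < s + t) : mulCoeff h s t p = 0 := by
  induction t generalizing p with
  | zero => simp [mulCoeff]; omega
  | succ t ih =>
    refine Finset.sum_eq_zero fun m hm => ?_
    rw [ih (by have := Finset.mem_range.1 hm; omega), mul_zero]

lemma mulCoeff_nonneg {h : ℝ} (hh : 0 ≤ h) (s t p : ℕ) : 0 ≤ mulCoeff h s t p := by
  induction t generalizing p with
  | zero => unfold mulCoeff; split_ifs <;> norm_num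
  | succ t ih =>
    refine Finset.sum_nonneg fun m _ => ?_
    rcases lt_or_ge m (s + t) with hm | hm
    · rw [mulCoeff_eq_zero h hm, mul_zero]
    · refine mul_nonneg (shiftCoeff_nonneg hh ?_ p) (ih m)
      gcongr
      omega

/-- Induction on `t`: the expansion for `t` is divided termwise by `x + t h`, and each quotient is
expanded by `hasSum_shiftCoeff` with `τ = t h`. -/
lemma hasSum_mulCoeff {h : ℝ} (hh : 0 < h) (s t : ℕ) {x : ℂ} (hx : 0 < x.re) :
    HasSum (fun p => (mulCoeff h s t p : ℂ) * invFactorial h p x)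
      (invFactorial h s x * invFactorial h t x) := by
  induction t generalizing x with
  | zero =>
    rw [invFactorial_zero, mul_one]
    convert hasSum_ite_eq s (invFactorial h s x) using 2 with p
    simp only [mulCoeff]
    split_ifs with hp
    · simp [hp]
    · simp
  | succ t ih =>
    have hreal : Summable fun m => mulCoeff h s t m * (risingFactorial h m x.re)⁻¹ := by
      have := (ih (x := (x.re : ℂ)) (by simpa)).summable
      simp only [invFactorial_ofReal] at this
      exact_mod_cast this
    have hth : 0 < x.re + t * h := by positivity
    have key := hasSum_kernel (R := ℂ) (ι := ℕ)
      -- Nonnegativity of the shift coefficients needs `t h ≤ m h`. Suppressing `m < t` loses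
      -- nothing, as `mulCoeff h s t m` vanishes there.
      (c := fun m p => if t ≤ m then shiftCoeff h (t * h) m p else 0)
      (w := fun p => (risingFactorial h p x.re)⁻¹) (e := fun p => invFactorial h p x)
      (Φ := fun m => if t ≤ m then (risingFactorial h m x.re)⁻¹ / (x.re + t * h) else 0)
      (φ := fun m => if t ≤ m then invFactorial h m x / (x + (t * h : ℝ)) else 0)
      (a := fun m => (mulCoeff h s t m : ℂ)) (b := fun p => (mulCoeff h s (t + 1) p : ℂ))
      (A := invFactorial h s x * invFactorial h (t + 1) x) ?_ ?_ ?_ ?_ ?_ ?_ ?_ ?_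
    · simpa only [smul_eq_mul, mul_comm] using key
    · intro m p
      split_ifs with htm
      · exact shiftCoeff_nonneg hh.le (by gcongr) p
      · exact le_rfl
    · exact fun p => inv_nonneg.2 (risingFactorial_pos hh.le hx p).le
    · exact norm_invFactorial_le hh.le hx le_rfl
    · intro m
      split_ifs with htm
      · exact hasSum_shiftCoeff_real hh (by gcongr) hx hth
      · simp
    · intro m
      split_ifs with htm
      · exact hasSum_shiftCoeff hh (by gcongr) hx hth
      · simp
    · refine (hreal.mul_right (x.re + t * h)⁻¹).congr fun m => ?_
      rw [Complex.norm_real, Real.norm_of_nonneg (mulCoeff_nonneg hh.le s t m)]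
      split_ifs with htm
      · ring
      · rw [mulCoeff_eq_zero h (by omega)]; simp
    · rw [invFactorial_succ, ← mul_div_assoc]
      convert (ih hx).div_const (x + t * h) using 2 with m
      split_ifs with htm
      · simp only [smul_eq_mul]; push_cast; ring
      · rw [mulCoeff_eq_zero h (by omega)]; simp
    · intro p
      simp only [mulCoeff, Complex.ofReal_sum, Complex.ofReal_mul, smul_eq_mul]
      have : ∀ m, ((if t ≤ m then shiftCoeff h (t * h) m p else 0 : ℝ) : ℂ) * mulCoeff h s t m
          = shiftCoeff h (t * h) m p * mulCoeff h s t m := fun m => by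
        split_ifs with htm
        · rfl
        · rw [mulCoeff_eq_zero h (by omega)]; simp
      simp_rw [this]
      refine hasSum_sum_of_ne_finset_zero fun m hm => ?_
      rw [shiftCoeff_of_le (by simpa using hm)]; simp

lemma hasSum_mulCoeff_real {h r : ℝ} (hh : 0 < h) (s t : ℕ) (hr : 0 < r) :
    HasSum (fun p => mulCoeff h s t p * (risingFactorial h p r)⁻¹)
      ((risingFactorial h s r)⁻¹ * (risingFactorial h t r)⁻¹) := by
  have := hasSum_mulCoeff hh s t (x := (r : ℂ)) (by simpa)
  simp only [invFactorial_ofReal] at this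
  exact_mod_cast this

/-! ### The weighted `ℓ¹` norm at a real point -/

variable {R : Type*} [NormedRing R] [NormedAlgebra ℂ R]

/-- The factorial series with coefficients `a` converges absolutely at the real point `r`. -/
def AbsConv (h r : ℝ) (a : ℕ → R) : Prop :=
  Summable fun s => (risingFactorial h s r)⁻¹ * ‖a s‖

/-- The sum of the absolute values of the terms of a factorial series at the real point `r`. -/
def absSum (h r : ℝ) (a : ℕ → R) : ℝ :=
  ∑' s, (risingFactorial h s r)⁻¹ * ‖a s‖

/-- The sum of a factorial series. -/
def sumAt (h : ℝ) (a : ℕ → R) (x : ℂ) : R :=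
  ∑' s, invFactorial h s x • a s

/-- The coefficients of the product of two factorial series. -/
def mulSeries (h : ℝ) (a b : ℕ → R) (m : ℕ) : R :=
  ∑ i ∈ Finset.range (m + 1) ×ˢ Finset.range (m + 1),
    (mulCoeff h i.1 i.2 m : ℂ) • (a i.1 * b i.2)

/-- The coefficients of the series `F (x - h) - F x`. -/
def diffSeries (h : ℝ) (a : ℕ → R) (m : ℕ) : R :=
  ∑ s ∈ Finset.range m, (shiftCoeff h (-h) s m : ℂ) • ((h : ℂ) • (s : ℂ) • a s)

omit [NormedAlgebra ℂ R] in
lemma absSum_nonneg {h r : ℝ} (hh : 0 ≤ h) (hr : 0 < r) (a : ℕ → R) : 0 ≤ absSum h r a :=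
  tsum_nonneg fun s => mul_nonneg (inv_nonneg.2 (risingFactorial_pos hh hr s).le) (norm_nonneg _)

omit [NormedAlgebra ℂ R] in
lemma AbsConv.mono {h r r' : ℝ} (hh : 0 ≤ h) (hr : 0 < r) (hrr' : r ≤ r') {a : ℕ → R}
    (ha : AbsConv h r a) : AbsConv h r' a := by
  refine Summable.of_nonneg_of_le (fun s => ?_) (fun s => ?_) ha
  · exact mul_nonneg (inv_nonneg.2 (risingFactorial_nonneg hh (hr.le.trans hrr') s))
      (norm_nonneg _)
  · refine mul_le_mul_of_nonneg_right ?_ (norm_nonneg _)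
    exact inv_anti₀ (risingFactorial_pos hh hr s) (risingFactorial_mono hh hr.le hrr' s)

omit [NormedAlgebra ℂ R] in
lemma AbsConv.of_norm_le {h r : ℝ} (hh : 0 ≤ h) (hr : 0 < r) {a : ℕ → R} {v : ℕ → ℝ} {S : ℝ}
    (hv : HasSum (fun s => (risingFactorial h s r)⁻¹ * v s) S) (hav : ∀ s, ‖a s‖ ≤ v s) :
    AbsConv h r a ∧ absSum h r a ≤ S := by
  have hle : ∀ s, (risingFactorial h s r)⁻¹ * ‖a s‖ ≤ (risingFactorial h s r)⁻¹ * v s := fun s =>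
    mul_le_mul_of_nonneg_left (hav s) (inv_nonneg.2 (risingFactorial_pos hh hr s).le)
  have h1 : AbsConv h r a := Summable.of_nonneg_of_le
    (fun s => mul_nonneg (inv_nonneg.2 (risingFactorial_pos hh hr s).le) (norm_nonneg _))
    hle hv.summable
  exact ⟨h1, hasSum_le hle h1.hasSum hv⟩

variable [CompleteSpace R]

lemma AbsConv.hasSum {h r : ℝ} (hh : 0 ≤ h) (hr : 0 < r) {a : ℕ → R} (ha : AbsConv h r a) {x : ℂ}
    (hx : r ≤ x.re) : HasSum (fun s => invFactorial h s x • a s) (sumAt h a x) := by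
  refine (Summable.of_norm_bounded ha fun s => ?_).hasSum
  rw [norm_smul]
  exact mul_le_mul_of_nonneg_right (norm_invFactorial_le hh hr hx s) (norm_nonneg _)

omit [NormedAlgebra ℂ R] [CompleteSpace R] in
lemma AbsConv.hasSum_mul {h r : ℝ} (hh : 0 ≤ h) (hr : 0 < r) {a b : ℕ → R}
    (ha : AbsConv h r a) (hb : AbsConv h r b) :
    HasSum (fun i : ℕ × ℕ => (risingFactorial h i.1 r)⁻¹ * (risingFactorial h i.2 r)⁻¹
      * (‖a i.1‖ * ‖b i.2‖)) (absSum h r a * absSum h r b) := by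
  have hnn : ∀ c : ℕ → R, 0 ≤ fun s => (risingFactorial h s r)⁻¹ * ‖c s‖ := fun c s =>
    mul_nonneg (inv_nonneg.2 (risingFactorial_pos hh hr s).le) (norm_nonneg _)
  have h1 := HasSum.mul (Summable.hasSum ha) (Summable.hasSum hb)
    (Summable.mul_of_nonneg ha hb (hnn a) (hnn b))
  exact hasSum_of_eq h1 fun i => by ring

omit [CompleteSpace R] in
-- As `mulCoeff` is nonnegative, the norms of the coefficients are majorized by the product of the
-- two series of norms, whose sum at `r` factors.
lemma AbsConv.mul_series {h r : ℝ} (hh : 0 < h) (hr : 0 < r) {a b : ℕ → R}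
    (ha : AbsConv h r a) (hb : AbsConv h r b) :
    AbsConv h r (mulSeries h a b) ∧ absSum h r (mulSeries h a b) ≤ absSum h r a * absSum h r b := by
  have key := hasSum_kernel_real (ι := ℕ × ℕ) (c := fun i m => mulCoeff h i.1 i.2 m)
    (w := fun m => (risingFactorial h m r)⁻¹)
    (Φ := fun i => (risingFactorial h i.1 r)⁻¹ * (risingFactorial h i.2 r)⁻¹)
    (v := fun i => ‖a i.1‖ * ‖b i.2‖) (S := absSum h r a * absSum h r b)
    (b := fun m => ∑ i ∈ Finset.range (m + 1) ×ˢ Finset.range (m + 1),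
      mulCoeff h i.1 i.2 m * (‖a i.1‖ * ‖b i.2‖))
    (fun i m => mulCoeff_nonneg hh.le _ _ _)
    (fun m => inv_nonneg.2 (risingFactorial_pos hh.le hr m).le) (fun i => by positivity)
    (fun i => hasSum_mulCoeff_real hh _ _ hr) (ha.hasSum_mul hh.le hr hb) (fun m => by
      refine hasSum_sum_of_ne_finset_zero fun i hi => ?_
      simp only [Finset.mem_product, Finset.mem_range, not_and_or, not_lt] at hi
      rw [mulCoeff_eq_zero h (by omega), zero_mul])
  refine AbsConv.of_norm_le hh.le hr key fun m => ?_
  refine (norm_sum_le _ _).trans (Finset.sum_le_sum fun i _ => ?_)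
  rw [norm_smul, Complex.norm_real, Real.norm_of_nonneg (mulCoeff_nonneg hh.le _ _ _)]
  exact mul_le_mul_of_nonneg_left (norm_mul_le _ _) (mulCoeff_nonneg hh.le _ _ _)

lemma AbsConv.hasSum_mulSeries {h r : ℝ} (hh : 0 < h) (hr : 0 < r) {a b : ℕ → R}
    (ha : AbsConv h r a) (hb : AbsConv h r b) {x : ℂ} (hx : r ≤ x.re) :
    HasSum (fun m => invFactorial h m x • mulSeries h a b m) (sumAt h a x * sumAt h b x) := by
  have hmul := ha.hasSum_mul hh.le hr hb
  refine hasSum_kernel (ι := ℕ × ℕ) (c := fun i m => mulCoeff h i.1 i.2 m)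
    (w := fun m => (risingFactorial h m r)⁻¹)
    (Φ := fun i => (risingFactorial h i.1 r)⁻¹ * (risingFactorial h i.2 r)⁻¹)
    (φ := fun i => invFactorial h i.1 x * invFactorial h i.2 x)
    (a := fun i => a i.1 * b i.2)
    (fun i m => mulCoeff_nonneg hh.le _ _ _)
    (fun m => inv_nonneg.2 (risingFactorial_pos hh.le hr m).le)
    (norm_invFactorial_le hh.le hr hx)
    (fun i => hasSum_mulCoeff_real hh _ _ hr)
    (fun i => hasSum_mulCoeff hh _ _ (hr.trans_le hx)) ?_ ?_ ?_
  · refine Summable.of_nonneg_of_le (fun i => ?_) (fun i => ?_) hmul.summable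
    · have h1 := (risingFactorial_pos hh.le hr i.1)
      have h2 := (risingFactorial_pos hh.le hr i.2)
      positivity
    · have h1 := (risingFactorial_pos hh.le hr i.1)
      have h2 := (risingFactorial_pos hh.le hr i.2)
      exact mul_le_mul_of_nonneg_left (norm_mul_le _ _) (by positivity)
  · have hs : ∀ i : ℕ × ℕ, (invFactorial h i.1 x * invFactorial h i.2 x) • (a i.1 * b i.2)
        = (invFactorial h i.1 x • a i.1) * (invFactorial h i.2 x • b i.2) := fun i => by
      rw [smul_mul_smul_comm]
    have h2 := ha.hasSum hh.le hr hx
    have h3 := hb.hasSum hh.le hr hx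
    refine hasSum_of_eq (h2.mul h3 ?_) fun i => (hs i).symm
    refine Summable.of_norm_bounded hmul.summable fun i => ?_
    rw [← hs, norm_smul, norm_mul]
    have h1 := (risingFactorial_pos hh.le hr i.1)
    exact mul_le_mul (mul_le_mul (norm_invFactorial_le hh.le hr hx _)
      (norm_invFactorial_le hh.le hr hx _) (norm_nonneg _) (by positivity)) (norm_mul_le _ _)
      (norm_nonneg _) (mul_nonneg (by positivity)
        (inv_nonneg.2 (risingFactorial_pos hh.le hr _).le))
  · intro m
    refine hasSum_sum_of_ne_finset_zero fun i hi => ?_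
    simp only [Finset.mem_product, Finset.mem_range, not_and_or, not_lt] at hi
    rw [mulCoeff_eq_zero h (by omega), Complex.ofReal_zero, zero_smul]

/-! ### The shift `x ↦ x - h` -/

omit [CompleteSpace R] in
-- The weights `s` in `diffSeries` satisfy `s ≤ m`; factoring out `m` leaves a majorant summable at
-- the same `r`. The factor `m` is recovered when `M ↦ A₀ M - M A₀ + m M` is inverted.
lemma exists_diffSeries_bound {h r : ℝ} (hh : 0 < h) (hr : h < r) {a : ℕ → R}
    (ha : AbsConv h r a) :
    ∃ v : ℕ → ℝ, HasSum (fun m => (risingFactorial h m r)⁻¹ * v m) (h / (r - h) * absSum h r a) ∧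
      (∀ m, 0 ≤ v m) ∧ ∀ m, ‖diffSeries h a m‖ ≤ m * v m := by
  have hr0 := hh.trans hr
  have hle : ∀ s : ℕ, -h ≤ s * h := fun s => by
    have : 0 ≤ (s : ℝ) * h := by positivity
    linarith
  refine ⟨fun m => ∑ s ∈ Finset.range m, shiftCoeff h (-h) s m * (h * ‖a s‖), ?_,
    fun m => ?_, fun m => ?_⟩
  · refine hasSum_kernel_real (c := fun s m => shiftCoeff h (-h) s m)
      (Φ := fun s => (risingFactorial h s r)⁻¹ / (r + -h)) (v := fun s => h * ‖a s‖)
      (fun s m => shiftCoeff_nonneg hh.le (hle s) m)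
      (fun m => inv_nonneg.2 (risingFactorial_pos hh.le hr0 m).le) (fun s => by positivity)
      (fun s => hasSum_shiftCoeff_real hh (hle s) hr0 (by linarith)) ?_ fun m => ?_
    · exact hasSum_of_eq ((Summable.hasSum ha).mul_left (h / (r - h))) fun s => by ring
    · refine hasSum_sum_of_ne_finset_zero fun s hs => ?_
      rw [shiftCoeff_of_le (by simpa using hs), zero_mul]
  · exact Finset.sum_nonneg fun s _ => mul_nonneg (shiftCoeff_nonneg hh.le (hle s) m)
      (by positivity)
  · refine (norm_sum_le _ _).trans ?_
    rw [Finset.mul_sum]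
    refine Finset.sum_le_sum fun s hs => ?_
    have hc := shiftCoeff_nonneg hh.le (hle s) m
    rw [norm_smul, norm_smul, norm_smul, Complex.norm_real, Complex.norm_real, Complex.norm_natCast,
      Real.norm_of_nonneg hc, Real.norm_of_nonneg hh.le]
    have hsm : (s : ℝ) ≤ m := by exact_mod_cast (Finset.mem_range.1 hs).le
    calc _ = s * (shiftCoeff h (-h) s m * (h * ‖a s‖)) := by ring
      _ ≤ _ := mul_le_mul_of_nonneg_right hsm (by positivity)

lemma AbsConv.hasSum_diffSeries {h r : ℝ} (hh : 0 < h) (hr : h < r) {a : ℕ → R}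
    (ha : AbsConv h r fun s => (s : ℂ) • a s) {x : ℂ} (hx : r ≤ x.re) :
    HasSum (fun m => invFactorial h m x • diffSeries h a m)
      (((h : ℂ) / (x - h)) • sumAt h (fun s => (s : ℂ) • a s) x) := by
  have hr0 := hh.trans hr
  have hle : ∀ s : ℕ, -h ≤ s * h := fun s => by
    have : 0 ≤ (s : ℝ) * h := by positivity
    linarith
  refine hasSum_kernel (c := fun s m => shiftCoeff h (-h) s m)
    (Φ := fun s => (risingFactorial h s r)⁻¹ / (r + -h))
    (φ := fun s => invFactorial h s x / (x + ((-h : ℝ) : ℂ)))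
    (w := fun m => (risingFactorial h m r)⁻¹) (a := fun s => (h : ℂ) • (s : ℂ) • a s)
    (fun s m => shiftCoeff_nonneg hh.le (hle s) m)
    (fun m => inv_nonneg.2 (risingFactorial_pos hh.le hr0 m).le)
    (norm_invFactorial_le hh.le hr0 hx)
    (fun s => hasSum_shiftCoeff_real hh (hle s) hr0 (by linarith))
    (fun s => hasSum_shiftCoeff hh (hle s) (hr0.trans_le hx) (by linarith)) ?_ ?_ fun m => ?_
  · refine (Summable.mul_left (h / (r - h)) ha).congr fun s => ?_
    rw [norm_smul (h : ℂ), Complex.norm_real, Real.norm_of_nonneg hh.le]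
    ring
  · refine hasSum_of_eq ((ha.hasSum hh.le hr0 hx).const_smul ((h : ℂ) / (x - h))) fun s => ?_
    simp only [smul_smul]
    congr 1
    push_cast
    ring
  · refine hasSum_sum_of_ne_finset_zero fun s hs => ?_
    rw [shiftCoeff_of_le (by simpa using hs), Complex.ofReal_zero, zero_smul]

lemma AbsConv.sumAt_sub {h r : ℝ} (hh : 0 < h) (hr : 0 < r) {a : ℕ → R} (ha : AbsConv h r a)
    (ha' : AbsConv h (r + h) fun s => (s : ℂ) • a s) {x : ℂ} (hx : r + h ≤ x.re) :
    sumAt h a (x - h) - sumAt h a x =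
      ((h : ℂ) / (x - h)) • sumAt h (fun s => (s : ℂ) • a s) x := by
  have h1 := ha.hasSum hh.le hr (x := x - h) (by simp; linarith)
  have h2 := ha.hasSum hh.le hr (x := x) (by linarith)
  have h3 := (ha'.hasSum hh.le (by linarith) hx).const_smul ((h : ℂ) / (x - h))
  refine (h1.sub h2).unique (hasSum_of_eq h3 fun s => ?_)
  rw [← sub_smul, invFactorial_sub hh (by linarith), smul_smul, smul_smul]
  congr 1
  ring

omit [CompleteSpace R] in
-- From `r (r + h)^{[s]} = r^{[s]} (r + s h)` one gets `s h r^{[s]} ≤ r (r + h)^{[s]}`: the weight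
-- `s` costs one step `h` in the abscissa.
lemma AbsConv.natCast_smul {h r : ℝ} (hh : 0 < h) (hr : 0 < r) {a : ℕ → R} (ha : AbsConv h r a) :
    AbsConv h (r + h) fun s => (s : ℂ) • a s := by
  refine Summable.of_nonneg_of_le (fun s => ?_) (fun s => ?_) (Summable.mul_left (r / h) ha)
  · exact mul_nonneg (inv_nonneg.2 (risingFactorial_pos hh.le (by linarith) s).le) (norm_nonneg _)
  · rw [norm_smul, Complex.norm_natCast, ← mul_assoc, ← mul_assoc]
    refine mul_le_mul_of_nonneg_right ?_ (norm_nonneg _)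
    have h1 : r * risingFactorial h s (r + h) = risingFactorial h s r * (r + s * h) := by
      rw [← risingFactorial_succ', risingFactorial_succ]
    have h2 := risingFactorial_pos hh.le hr s
    have h3 := risingFactorial_pos hh.le (r := r + h) (by linarith) s
    rw [inv_mul_eq_div, ← div_eq_mul_inv, div_div, div_le_div_iff₀ h3 (by positivity)]
    have : r * risingFactorial h s (r + h) - s * (h * risingFactorial h s r)
      = r * risingFactorial h s r := by rw [h1]; ring
    nlinarith [mul_pos hr h2]

end Products

section Convergence

/-! ### The filter of right half-planes -/

lemma eventually_rightEnd {P : ℂ → Prop} :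
    (∀ᶠ x in rightEnd, P x) ↔ ∃ σ : ℝ, ∀ x : ℂ, σ ≤ x.re → P x := by
  rw [rightEnd, eventually_comap, eventually_atTop]
  constructor
  · rintro ⟨σ, hσ⟩
    exact ⟨σ, fun x hx => hσ _ hx x rfl⟩
  · rintro ⟨σ, hσ⟩
    exact ⟨σ, fun b hb x hx => hσ x (hx ▸ hb)⟩

lemma tendsto_re_rightEnd : Tendsto Complex.re rightEnd atTop := tendsto_comap

instance : rightEnd.NeBot := by
  refine ⟨fun hbot => ?_⟩
  have h1 : ∀ᶠ _ in rightEnd, False := by rw [hbot]; exact eventually_bot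
  obtain ⟨σ, hσ⟩ := eventually_rightEnd.1 h1
  exact hσ (σ : ℂ) (by simp)

lemma tendsto_sub_rightEnd (h : ℝ) : Tendsto (fun x : ℂ => x - h) rightEnd rightEnd := by
  rw [rightEnd, tendsto_comap_iff]
  have : Complex.re ∘ (fun x : ℂ => x - h) = fun x => x.re + -h := by
    funext x; simp [sub_eq_add_neg]
  rw [this]
  exact tendsto_atTop_add_const_right _ _ tendsto_comap

/-! ### Tails, values at infinity and uniqueness of coefficients -/

variable {R : Type*} [NormedRing R] [NormedAlgebra ℂ R]

/-- The series with its constant term removed. -/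
def tailSeries (a : ℕ → R) (s : ℕ) : R := if s = 0 then 0 else a s

omit [NormedAlgebra ℂ R] in
lemma tailSeries_zero (a : ℕ → R) : tailSeries a 0 = 0 := if_pos rfl

omit [NormedAlgebra ℂ R] in
lemma tailSeries_succ (a : ℕ → R) (s : ℕ) : tailSeries a (s + 1) = a (s + 1) :=
  if_neg s.succ_ne_zero

omit [NormedAlgebra ℂ R] in
lemma absConv_tailSeries_iff {h r : ℝ} {a : ℕ → R} :
    AbsConv h r (tailSeries a) ↔ AbsConv h r a := by
  unfold AbsConv
  rw [← summable_nat_add_iff 1]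
  simp only [tailSeries_succ]
  rw [summable_nat_add_iff 1 (f := fun s => (risingFactorial h s r)⁻¹ * ‖a s‖)]

omit [NormedAlgebra ℂ R] in
-- The majorant is `C` times the expansion of `1 / (x - l)` at `x = r`.
lemma absConv_of_norm_le_risingFactorial {h l r C : ℝ} (hh : 0 < h) (hl : 0 ≤ l) (hlr : l < r)
    {a : ℕ → R} (ha : ∀ s, ‖a (s + 1)‖ ≤ C * risingFactorial h s l) :
    AbsConv h r a ∧ absSum h r (tailSeries a) ≤ C / (r - l) := by
  have hr : 0 < r := hl.trans_lt hlr
  have h1 := (hasSum_shiftCoeff_real (m := 0) (τ := -l) (r := r) hh (by simpa) hr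
    (by linarith)).mul_left C
  have h2 : HasSum (fun s => (risingFactorial h s r)⁻¹ * (C * shiftCoeff h (-l) 0 s))
      (C / (r - l)) := by
    have h3 : C * ((risingFactorial h 0 r)⁻¹ / (r + -l)) = C / (r - l) := by
      rw [risingFactorial_zero]; ring
    rw [h3] at h1
    exact hasSum_of_eq h1 fun s => by ring
  have h4 := AbsConv.of_norm_le hh.le hr (a := tailSeries a) h2 fun s => by
    rcases s with _ | s
    · rw [tailSeries_zero, shiftCoeff_of_le le_rfl]; simp
    · rw [tailSeries_succ]
      simpa [shiftCoeff] using ha s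
  exact ⟨absConv_tailSeries_iff.1 h4.1, h4.2⟩

/-- Convergence at a real point `r` bounds the terms, so `a_s = O(r^{[s]})`; since `r^{[s+1]} = r (r
+ h)^{[s]}`, absolute convergence holds to the right of `r + h`. -/
lemma exists_absConv {h : ℝ} (hh : 0 < h) {a : ℕ → R}
    (ha : ∀ᶠ x in rightEnd, ∃ S, Tendsto
      (fun m : ℕ => ∑ s ∈ Finset.range m, invFactorial h s x • a s) atTop (𝓝 S)) :
    ∃ r, 0 < r ∧ AbsConv h r a := by
  obtain ⟨σ, hσ⟩ := eventually_rightEnd.1 ha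
  set r := max σ 1
  have hr : 0 < r := lt_of_lt_of_le one_pos (le_max_right _ _)
  obtain ⟨S, hS⟩ := hσ (r : ℂ) (le_max_left σ 1)
  have hterm : Tendsto (fun s => invFactorial h s (r : ℂ) • a s) atTop (𝓝 0) := by
    have := (hS.comp (tendsto_add_atTop_nat 1)).sub hS
    simpa [Function.comp_def, Finset.sum_range_succ] using this
  obtain ⟨B, hB⟩ := hterm.norm.bddAbove_range
  have hbound : ∀ s, ‖a s‖ ≤ B * risingFactorial h s r := fun s => by
    have h1 : ‖invFactorial h s (r : ℂ) • a s‖ ≤ B := hB ⟨s, rfl⟩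
    have h2 := risingFactorial_pos hh.le hr s
    rw [norm_smul, invFactorial_ofReal, Complex.norm_real, Real.norm_of_nonneg (by positivity),
      inv_mul_eq_div, div_le_iff₀ h2] at h1
    exact h1
  refine ⟨r + 2 * h, by positivity, (absConv_of_norm_le_risingFactorial (l := r + h) (C := B * r)
    hh (by positivity) (by linarith) fun s => ?_).1⟩
  have := hbound (s + 1)
  rwa [risingFactorial_succ', ← mul_assoc] at this

omit [NormedAlgebra ℂ R] in
lemma absSum_tailSeries_le {h r r' : ℝ} (hh : 0 ≤ h) (hr : 0 < r) (hrr' : r ≤ r') {a : ℕ → R}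
    (ha : AbsConv h r a) :
    absSum h r' (tailSeries a) ≤ r / r' * absSum h r (tailSeries a) := by
  have hr' := hr.trans_le hrr'
  refine hasSum_le (fun s => ?_) (Summable.hasSum (absConv_tailSeries_iff.2 (ha.mono hh hr hrr')))
    ((Summable.hasSum (absConv_tailSeries_iff.2 ha)).mul_left (r / r'))
  rcases s with _ | s
  · simp [tailSeries_zero]
  · rw [← mul_assoc]
    refine mul_le_mul_of_nonneg_right ?_ (norm_nonneg _)
    rw [risingFactorial_succ', risingFactorial_succ', mul_inv, mul_inv, ← mul_assoc,
      div_mul_eq_mul_div, mul_inv_cancel₀ hr.ne', one_div]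
    refine mul_le_mul_of_nonneg_left ?_ (by positivity)
    exact inv_anti₀ (risingFactorial_pos hh (by linarith) s)
      (risingFactorial_mono hh (by linarith) (by linarith) s)

omit [NormedAlgebra ℂ R] in
lemma exists_absSum_tailSeries_le {h r ε : ℝ} (hh : 0 ≤ h) (hr : 0 < r) (hε : 0 < ε) {a : ℕ → R}
    (ha : AbsConv h r a) : ∃ ρ, ∀ r', ρ ≤ r' → AbsConv h r' a ∧ absSum h r' (tailSeries a) ≤ ε := by
  set K := absSum h r (tailSeries a)
  have hK : 0 ≤ K := absSum_nonneg hh hr _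
  refine ⟨max r (r * K / ε), fun r' hr' => ?_⟩
  have h1 : r ≤ r' := (le_max_left _ _).trans hr'
  have h2 : r * K / ε ≤ r' := (le_max_right _ _).trans hr'
  refine ⟨ha.mono hh hr h1, (absSum_tailSeries_le hh hr h1 ha).trans ?_⟩
  rw [div_le_iff₀ hε] at h2
  rw [div_mul_eq_mul_div, div_le_iff₀ (hr.trans_le h1)]
  linarith

variable [CompleteSpace R]

omit [CompleteSpace R] in
lemma AbsConv.norm_sumAt_le {h r : ℝ} (hh : 0 ≤ h) (hr : 0 < r) {a : ℕ → R} (ha : AbsConv h r a)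
    {x : ℂ} (hx : r ≤ x.re) : ‖sumAt h a x‖ ≤ absSum h r a := by
  refine tsum_of_norm_bounded (Summable.hasSum ha) fun s => ?_
  rw [norm_smul]
  exact mul_le_mul_of_nonneg_right (norm_invFactorial_le hh hr hx s) (norm_nonneg _)

omit [CompleteSpace R] in
lemma hasSum_const (h : ℝ) (x : ℂ) (c : R) :
    HasSum (fun s => invFactorial h s x • if s = 0 then c else 0) c := by
  have h1 := hasSum_ite_eq 0 c
  refine hasSum_of_eq h1 fun s => ?_
  split_ifs with hs
  · rw [hs, invFactorial_zero, one_smul]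
  · rw [smul_zero]

lemma AbsConv.sumAt_eq_add {h r : ℝ} (hh : 0 ≤ h) (hr : 0 < r) {a : ℕ → R} (ha : AbsConv h r a)
    {x : ℂ} (hx : r ≤ x.re) : sumAt h a x = a 0 + sumAt h (tailSeries a) x := by
  refine (ha.hasSum hh hr hx).unique ?_
  refine hasSum_of_eq ((hasSum_const h x (a 0)).add
    ((absConv_tailSeries_iff.2 ha).hasSum hh hr hx)) fun s => ?_
  rcases s with _ | s
  · simp [tailSeries_zero]
  · simp [tailSeries_succ]

lemma AbsConv.tendsto_sumAt {h r : ℝ} (hh : 0 ≤ h) (hr : 0 < r) {a : ℕ → R} (ha : AbsConv h r a) :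
    Tendsto (sumAt h a) rightEnd (𝓝 (a 0)) := by
  rw [← tendsto_sub_nhds_zero_iff]
  have hlim : Tendsto (fun x : ℂ => r / x.re * absSum h r (tailSeries a)) rightEnd (𝓝 0) := by
    simpa using (tendsto_re_rightEnd.const_div_atTop r).mul_const (absSum h r (tailSeries a))
  refine squeeze_zero_norm' ?_ hlim
  refine eventually_rightEnd.2 ⟨r, fun x hx => ?_⟩
  rw [ha.sumAt_eq_add hh hr hx, add_sub_cancel_left]
  have h1 := absConv_tailSeries_iff.2 (ha.mono hh hr hx)
  exact (h1.norm_sumAt_le hh (hr.trans_le hx) le_rfl).trans (absSum_tailSeries_le hh hr hx ha)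

/-- The constant term is the value at infinity. If it vanishes, multiplying by `x` and setting `y =
x + h` gives a factorial series in `y` with coefficients moved down by one. -/
lemma AbsConv.eq_zero {h r : ℝ} (hh : 0 ≤ h) (hr : 0 < r) {a : ℕ → R} (ha : AbsConv h r a)
    (h0 : ∀ᶠ x in rightEnd, sumAt h a x = 0) (k : ℕ) : a k = 0 := by
  have key : ∀ (r : ℝ) (a : ℕ → R), 0 < r → AbsConv h r a →
      (∀ᶠ x in rightEnd, sumAt h a x = 0) → a 0 = 0 := fun r a hr ha h0 =>
    tendsto_nhds_unique (ha.tendsto_sumAt hh hr) (tendsto_nhds_of_eventually_eq h0)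
  induction k generalizing a r with
  | zero => exact key r a hr ha h0
  | succ k ih =>
    have ha0 := key r a hr ha h0
    have ha' : AbsConv h (r + h) fun s => a (s + 1) := by
      have h1 : Summable fun s => (risingFactorial h (s + 1) r)⁻¹ * ‖a (s + 1)‖ :=
        (summable_nat_add_iff 1).2 ha
      refine (h1.mul_left r).congr fun s => ?_
      rw [risingFactorial_succ', mul_inv, ← mul_assoc, ← mul_assoc, mul_inv_cancel₀ hr.ne', one_mul]
    refine ih (by linarith) ha' ?_
    obtain ⟨σ, hσ⟩ := eventually_rightEnd.1 h0
    refine eventually_rightEnd.2 ⟨max σ r + h, fun y hy => ?_⟩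
    have hx : max σ r ≤ (y - h).re := by
      rw [Complex.sub_re, Complex.ofReal_re]; linarith
    have hxr : r ≤ (y - h).re := (le_max_right _ _).trans hx
    have hne : y - h ≠ 0 := fun h0 => by rw [h0, Complex.zero_re] at hxr; linarith
    have h1 := ha.hasSum hh hr hxr
    rw [hσ _ ((le_max_left _ _).trans hx), ← hasSum_nat_add_iff' 1] at h1
    simp only [Finset.range_one, Finset.sum_singleton, ha0, smul_zero, sub_zero] at h1
    have h2 := h1.const_smul (y - h)
    rw [smul_zero] at h2
    refine ((ha'.hasSum hh (by linarith) (x := y)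
      (by linarith [le_max_right σ r])).unique (hasSum_of_eq h2 fun s => ?_))
    rw [invFactorial_succ', sub_add_cancel, smul_smul, mul_div_cancel₀ _ hne]

/-! ### Causal fixed points -/

/-- Iterates from `0` are stationary at index `s` after `s + 1` steps. -/
lemma exists_causal_fixedPoint {E : Type*} [Zero E] {T : (ℕ → E) → ℕ → E}
    (hT : ∀ s u v, (∀ j < s, u j = v j) → T u s = T v s) : ∃ f, ∀ s, f s = T f s := by
  have stable : ∀ k, ∀ s < k, T^[k + 1] 0 s = T^[k] 0 s := fun k => by
    induction k with
    | zero => intro s hs; omega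
    | succ k ih =>
      intro s hs
      have h1 := hT s (T^[k + 1] 0) (T^[k] 0) fun j hj => ih j (by omega)
      rwa [← Function.iterate_succ_apply' T, ← Function.iterate_succ_apply' T] at h1
  have hlim : ∀ s k, s < k → T^[k] 0 s = T^[s + 1] 0 s := fun s k hk => by
    induction k, (Nat.succ_le_of_lt hk) using Nat.le_induction with
    | base => rfl
    | succ k hk' ih => rw [stable k s hk', ih hk']
  refine ⟨fun s => T^[s + 1] 0 s, fun s => ?_⟩
  dsimp only
  rw [Function.iterate_succ_apply' T s]
  exact hT s _ _ fun j hj => hlim j s hj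

lemma causal_fixedPoint_unique {E : Type*} {T : (ℕ → E) → ℕ → E}
    (hT : ∀ s u v, (∀ j < s, u j = v j) → T u s = T v s) {f g : ℕ → E} (hf : ∀ s, f s = T f s)
    (hg : ∀ s, g s = T g s) : f = g := by
  funext s
  induction s using Nat.strong_induction_on with
  | _ s ih => rw [hf, hg, hT s f g ih]

omit [NormedAlgebra ℂ R] [CompleteSpace R] in
-- Truncate `f` to indices below `m`. By causality `T` of the truncation agrees with `f` up to index
-- `m`, so the partial sums satisfy `P_{m+1} ≤ c + q P_m`, which preserves the bound `c / (1 - q)`.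
lemma AbsConv.of_causal_fixedPoint {h r c q : ℝ} (hh : 0 ≤ h) (hr : 0 < r) (hc : 0 ≤ c)
    (hq : 0 ≤ q) (hq1 : q < 1) {T : (ℕ → R) → ℕ → R}
    (hT : ∀ s u v, (∀ j < s, u j = v j) → T u s = T v s)
    (hb : ∀ u, AbsConv h r u → AbsConv h r (T u) ∧ absSum h r (T u) ≤ c + q * absSum h r u)
    {f : ℕ → R} (hf : ∀ s, f s = T f s) : AbsConv h r f ∧ absSum h r f ≤ c / (1 - q) := by
  have hq' : 0 < 1 - q := by linarith
  have hnn : ∀ (u : ℕ → R) s, 0 ≤ (risingFactorial h s r)⁻¹ * ‖u s‖ := fun u s =>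
    mul_nonneg (inv_nonneg.2 (risingFactorial_pos hh hr s).le) (norm_nonneg _)
  have hpart : ∀ m, ∑ s ∈ Finset.range m, (risingFactorial h s r)⁻¹ * ‖f s‖ ≤ c / (1 - q) := by
    intro m
    induction m with
    | zero => simpa using div_nonneg hc hq'.le
    | succ m ih =>
      set u : ℕ → R := fun j => if j < m then f j else 0 with hu
      have hu1 : HasSum (fun s => (risingFactorial h s r)⁻¹ * ‖u s‖)
          (∑ s ∈ Finset.range m, (risingFactorial h s r)⁻¹ * ‖f s‖) := by
        have : ∑ s ∈ Finset.range m, (risingFactorial h s r)⁻¹ * ‖f s‖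
            = ∑ s ∈ Finset.range m, (risingFactorial h s r)⁻¹ * ‖u s‖ :=
          Finset.sum_congr rfl fun s hs => by
            simp only [hu]; rw [if_pos (Finset.mem_range.1 hs)]
        rw [this]
        refine hasSum_sum_of_ne_finset_zero fun s hs => ?_
        simp only [hu]
        rw [if_neg (by simpa using hs)]; simp
      obtain ⟨hTu, hle⟩ := hb u hu1.summable
      have h1 : absSum h r u = _ := hu1.tsum_eq
      rw [h1] at hle
      have h2 : ∑ s ∈ Finset.range (m + 1), (risingFactorial h s r)⁻¹ * ‖f s‖
          ≤ absSum h r (T u) := by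
        have : ∑ s ∈ Finset.range (m + 1), (risingFactorial h s r)⁻¹ * ‖f s‖
            = ∑ s ∈ Finset.range (m + 1), (risingFactorial h s r)⁻¹ * ‖T u s‖ :=
          Finset.sum_congr rfl fun s hs => by
            rw [hf s, hT s f u fun j hj => ?_]
            have := Finset.mem_range.1 hs
            simp only [hu]; rw [if_pos (by omega)]
        rw [this]
        exact hTu.sum_le_tsum _ fun s _ => hnn _ s
      refine (h2.trans hle).trans ?_
      calc c + q * _ ≤ c + q * (c / (1 - q)) := by gcongr
        _ = c / (1 - q) := by field_simp; ring
  have hsum : AbsConv h r f := summable_of_sum_range_le (hnn f) hpart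
  exact ⟨hsum, Real.tsum_le_of_sum_range_le (hnn f) hpart⟩

omit [CompleteSpace R] in
lemma mulSeries_causal {h : ℝ} {a : ℕ → R} (ha : a 0 = 0) {u v : ℕ → R} {s : ℕ}
    (huv : ∀ j < s, u j = v j) : mulSeries h a u s = mulSeries h a v s := by
  refine Finset.sum_congr rfl fun i _ => ?_
  rcases Nat.eq_zero_or_pos i.1 with h0 | h0
  · rw [h0, ha, zero_mul, zero_mul]
  · rcases lt_or_ge i.2 s with h1 | h1
    · rw [huv _ h1]
    · rw [mulCoeff_eq_zero h (by omega), Complex.ofReal_zero, zero_smul, zero_smul]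

omit [CompleteSpace R] in
lemma diffSeries_causal {h : ℝ} {u v : ℕ → R} {s : ℕ}
    (huv : ∀ j < s, u j = v j) : diffSeries h u s = diffSeries h v s :=
  Finset.sum_congr rfl fun j hj => by rw [huv j (Finset.mem_range.1 hj)]

/-- A factorial series with constant term `1` has a right inverse. -/
lemma AbsConv.exists_inverse {h r : ℝ} (hh : 0 < h) (hr : 0 < r) {f : ℕ → R} (hf : AbsConv h r f)
    (hf0 : f 0 = 1) : ∃ r' > 0, ∃ g : ℕ → R, AbsConv h r' g ∧
      ∀ x : ℂ, r' ≤ x.re → sumAt h f x * sumAt h g x = 1 := by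
  obtain ⟨ρ, hρ⟩ := exists_absSum_tailSeries_le hh.le hr (ε := 1 / 2) (by norm_num) hf
  set r' := max r ρ
  have hr' : 0 < r' := hr.trans_le (le_max_left _ _)
  obtain ⟨hf', hle⟩ := hρ r' (le_max_right _ _)
  have htail := absConv_tailSeries_iff.2 hf'
  -- The inverse solves `g = 1 - (f - 1) g`, where `f - 1` has norm at most `1/2` at `r'`.
  set T : (ℕ → R) → ℕ → R := fun u s => (if s = 0 then 1 else 0) - mulSeries h (tailSeries f) u s
    with hTdef
  have hT : ∀ s u v, (∀ j < s, u j = v j) → T u s = T v s := fun s u v huv => by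
    simp only [hTdef]
    rw [mulSeries_causal (tailSeries_zero f) huv]
  obtain ⟨g, hg⟩ := exists_causal_fixedPoint hT
  have hone : HasSum (fun s => (risingFactorial h s r')⁻¹ * ‖if s = 0 then (1 : R) else 0‖)
      ‖(1 : R)‖ := by
    refine hasSum_of_eq (hasSum_ite_eq 0 ‖(1 : R)‖) fun s => ?_
    split_ifs with hs
    · rw [hs, risingFactorial_zero]; simp
    · simp
  have hg' : AbsConv h r' g := by
    refine (AbsConv.of_causal_fixedPoint hh.le hr' (c := ‖(1 : R)‖) (q := 1 / 2) (norm_nonneg _)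
      (by norm_num) (by norm_num) hT (fun u hu => ?_) hg).1
    obtain ⟨h1, h2⟩ := htail.mul_series hh hr' hu
    obtain ⟨h3, h4⟩ := AbsConv.of_norm_le hh.le hr' (a := T u)
      (hasSum_of_eq (hone.add (Summable.hasSum h1)) fun s => (mul_add _ _ _).symm)
      fun s => norm_sub_le _ _
    refine ⟨h3, h4.trans ?_⟩
    have : absSum h r' (mulSeries h (tailSeries f) u) ≤ 1 / 2 * absSum h r' u :=
      h2.trans (mul_le_mul_of_nonneg_right hle (absSum_nonneg hh.le hr' u))
    exact add_le_add_right this _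
  refine ⟨r', hr', g, hg', fun x hx => ?_⟩
  have h1 := (hasSum_const h x (1 : R)).sub (htail.hasSum_mulSeries hh hr' hg' hx)
  have h2 := (hg'.hasSum hh.le hr' hx).unique (hasSum_of_eq h1 fun s => by
    rw [hg s, ← smul_sub])
  rw [hf'.sumAt_eq_add hh.le hr' hx, hf0, add_mul, one_mul]
  nth_rewrite 1 [h2]
  rw [sub_add_cancel]

end Convergence

section GaugeEquation

variable {R : Type*} [NormedRing R] [NormedAlgebra ℂ R]

/-! ### The gauge equation on coefficients -/

/-- The coefficients of `A(x) F(x) - F(x - h) A₀ + (x - h) (F(x - h) - F(x)) / h`. -/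
def gaugeSeries (h : ℝ) (a₀ : R) (a g : ℕ → R) (s : ℕ) : R :=
  a₀ * g s - g s * a₀ + (s : ℂ) • g s + mulSeries h (tailSeries a) g s - diffSeries h g s * a₀

/-- The factor `(x-h)/h` cancels the `h/(x-h)` of `AbsConv.sumAt_sub` and leaves the series of `s
g_s`; splitting `F(x-h)` as `F(x)` plus the difference series produces the commutator. -/
lemma AbsConv.hasSum_gaugeSeries [CompleteSpace R] {h r : ℝ} (hh : 0 < h) (hr : 0 < r)
    {a g : ℕ → R}
    (ha : AbsConv h r a) (hg : AbsConv h r g) {x : ℂ} (hx : r + h ≤ x.re) :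
    HasSum (fun s => invFactorial h s x • gaugeSeries h (a 0) a g s)
      (sumAt h a x * sumAt h g x - sumAt h g (x - h) * a 0
        + ((x - h) / h) • (sumAt h g (x - h) - sumAt h g x)) := by
  have hxr : r ≤ x.re := by linarith
  have hne : x - h ≠ 0 := fun h0 => by
    have := congrArg Complex.re h0
    simp at this
    linarith
  have hhc : (h : ℂ) ≠ 0 := by exact_mod_cast hh.ne'
  have hg' := hg.natCast_smul hh hr
  have hG := hg.hasSum hh.le hr hxr
  have hD := hg'.hasSum hh.le (by linarith) hx
  have hdiff := hg'.hasSum_diffSeries hh (by linarith) hx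
  have hmul := (absConv_tailSeries_iff.2 ha).hasSum_mulSeries hh hr hg hxr
  have key := ((((hG.mul_left (a 0)).sub (hG.mul_right (a 0))).add hD).add hmul).sub
    (hdiff.mul_right (a 0))
  rw [← hg.sumAt_sub hh hr hg' hx] at key
  have hval : sumAt h a x * sumAt h g x - sumAt h g (x - h) * a 0
        + ((x - h) / h) • (sumAt h g (x - h) - sumAt h g x)
      = a 0 * sumAt h g x - sumAt h g x * a 0 + sumAt h (fun s => (s : ℂ) • g s) x
        + sumAt h (tailSeries a) x * sumAt h g x
        - (sumAt h g (x - h) - sumAt h g x) * a 0 := by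
    rw [ha.sumAt_eq_add hh.le hr hxr, add_mul, sub_mul]
    have : ((x - h) / h) • (sumAt h g (x - h) - sumAt h g x)
        = sumAt h (fun s => (s : ℂ) • g s) x := by
      rw [hg.sumAt_sub hh hr hg' hx, smul_smul, div_mul_div_cancel₀' hne, div_self hhc, one_smul]
    rw [this]
    abel
  rw [hval]
  refine hasSum_of_eq key fun s => ?_
  simp only [gaugeSeries, smul_sub, smul_add, mul_smul_comm, smul_mul_assoc]

/-- The map whose fixed points are the series with constant term `1` that solve the gauge
equation. -/
def gaugeMap (h : ℝ) (a₀ : R) (a : ℕ → R) (L : ℕ → R → R) (u : ℕ → R) (s : ℕ) : R :=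
  if s = 0 then 1 else L s (diffSeries h u s * a₀ - mulSeries h (tailSeries a) u s)

lemma gaugeMap_causal {h : ℝ} {a₀ : R} {a : ℕ → R} {L : ℕ → R → R} (s : ℕ) (u v : ℕ → R)
    (huv : ∀ j < s, u j = v j) : gaugeMap h a₀ a L u s = gaugeMap h a₀ a L v s := by
  unfold gaugeMap
  rw [mulSeries_causal (tailSeries_zero a) huv, diffSeries_causal huv]

lemma mulSeries_tailSeries_zero (h : ℝ) (a g : ℕ → R) : mulSeries h (tailSeries a) g 0 = 0 := by
  simp [mulSeries, tailSeries_zero]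

lemma diffSeries_zero (h : ℝ) (g : ℕ → R) : diffSeries h g 0 = 0 := by
  simp [diffSeries]

/-- At index `0` the equation only says that `g 0` commutes with `a₀`, so the value `1` can be
prescribed. -/
lemma eq_gaugeMap_iff {h : ℝ} {a₀ : R} {a : ℕ → R} {L : ℕ → R → R}
    (hL : ∀ s, 1 ≤ s → ∀ y z, L s y = z ↔ a₀ * z - z * a₀ + (s : ℂ) • z = y) {g : ℕ → R} :
    (∀ s, g s = gaugeMap h a₀ a L g s) ↔ g 0 = 1 ∧ ∀ s, gaugeSeries h a₀ a g s = 0 := by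
  have hs : ∀ s, 1 ≤ s → (g s = gaugeMap h a₀ a L g s ↔ gaugeSeries h a₀ a g s = 0) := by
    intro s hs
    rw [gaugeMap, if_neg (by omega), eq_comm, hL s hs, gaugeSeries, eq_sub_iff_add_eq, sub_eq_zero]
  constructor
  · intro hg
    have h0 : g 0 = 1 := hg 0
    refine ⟨h0, fun s => ?_⟩
    rcases Nat.eq_zero_or_pos s with rfl | hpos
    · simp [gaugeSeries, h0, mulSeries_tailSeries_zero, diffSeries_zero]
    · exact (hs s hpos).1 (hg s)
  · rintro ⟨h0, hg⟩ s
    rcases Nat.eq_zero_or_pos s with rfl | hpos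
    · exact h0
    · exact (hs s hpos).2 (hg s)

/-- The gain `1/s` in `hL` offsets the factor `s` of `exists_diffSeries_bound`, so the linear part
of `gaugeMap` has norm at most `q`; the prescribed constant term contributes `‖1‖`. -/
lemma AbsConv.of_eq_gaugeMap {h r κ q : ℝ} (hh : 0 < h) (hr : h < r) (hκ : 0 ≤ κ) {a₀ : R}
    {a : ℕ → R} {L : ℕ → R → R} (hL : ∀ s : ℕ, 1 ≤ s → ∀ y, s * ‖L s y‖ ≤ κ * ‖y‖)
    (ha : AbsConv h r a) (hq : κ * (‖a₀‖ * (h / (r - h)) + absSum h r (tailSeries a)) ≤ q)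
    (hq1 : q < 1) {f : ℕ → R} (hf : ∀ s, f s = gaugeMap h a₀ a L f s) :
    AbsConv h r f ∧ absSum h r f ≤ ‖(1 : R)‖ / (1 - q) := by
  have hr0 : 0 < r := hh.trans hr
  have htail := absConv_tailSeries_iff.2 ha
  have hrh : 0 < r - h := by linarith
  have hq0 : 0 ≤ q := le_trans (by have := absSum_nonneg hh.le hr0 (tailSeries a); positivity) hq
  refine AbsConv.of_causal_fixedPoint hh.le hr0 (norm_nonneg _) hq0 hq1 gaugeMap_causal
    (fun u hu => ?_) hf
  obtain ⟨v, hv, hv0, hdv⟩ := exists_diffSeries_bound hh hr hu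
  obtain ⟨h1, h2⟩ := htail.mul_series hh hr0 hu
  have hone : HasSum (fun s => (risingFactorial h s r)⁻¹ * if s = 0 then ‖(1 : R)‖ else 0)
      ‖(1 : R)‖ := by
    refine hasSum_of_eq (hasSum_ite_eq 0 ‖(1 : R)‖) fun s => ?_
    split_ifs with hs
    · rw [hs, risingFactorial_zero]; simp
    · simp
  have hsum := hone.add (((hv.mul_left ‖a₀‖).add (Summable.hasSum h1)).mul_left κ)
  obtain ⟨h3, h4⟩ := AbsConv.of_norm_le hh.le hr0 (a := gaugeMap h a₀ a L u)
    (v := fun s => (if s = 0 then ‖(1 : R)‖ else 0)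
      + κ * (‖a₀‖ * v s + ‖mulSeries h (tailSeries a) u s‖))
    (hasSum_of_eq hsum fun s => by ring) fun s => by
      have hnn : 0 ≤ κ * (‖a₀‖ * v s + ‖mulSeries h (tailSeries a) u s‖) := by
        have := hv0 s
        positivity
      rcases Nat.eq_zero_or_pos s with rfl | hpos
      · rw [gaugeMap, if_pos rfl, if_pos rfl]
        linarith
      · rw [gaugeMap, if_neg hpos.ne', if_neg hpos.ne', zero_add]
        have hs1 : (1 : ℝ) ≤ s := by exact_mod_cast hpos
        refine le_of_mul_le_mul_left ?_ (lt_of_lt_of_le one_pos hs1)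
        refine (hL s hpos _).trans ?_
        rw [mul_left_comm]
        refine mul_le_mul_of_nonneg_left ?_ hκ
        refine (norm_sub_le _ _).trans ?_
        rw [mul_add]
        refine add_le_add ?_ (le_mul_of_one_le_left (norm_nonneg _) hs1)
        refine (norm_mul_le _ _).trans ?_
        calc _ ≤ s * v s * ‖a₀‖ := mul_le_mul_of_nonneg_right (hdv s) (norm_nonneg _)
          _ = _ := by ring
  refine ⟨h3, h4.trans (add_le_add_right ?_ _)⟩
  have h5 := absSum_nonneg hh.le hr0 u
  calc _ ≤ κ * (‖a₀‖ * (h / (r - h) * absSum h r u)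
        + absSum h r (tailSeries a) * absSum h r u) := by
        refine mul_le_mul_of_nonneg_left (add_le_add_right h2 _) hκ
    _ = κ * (‖a₀‖ * (h / (r - h)) + absSum h r (tailSeries a)) * absSum h r u := by ring
    _ ≤ q * absSum h r u := mul_le_mul_of_nonneg_right hq h5

/-- The coefficients of a solution of the gauge equation satisfy the equation on coefficients. -/
lemma AbsConv.gaugeSeries_eq_zero [CompleteSpace R] {h r : ℝ} (hh : 0 < h) (hr : 0 < r)
    {a g : ℕ → R} (ha : AbsConv h r a) (hg : AbsConv h r g)
    (heq : ∀ᶠ x in rightEnd, sumAt h a x * sumAt h g x - sumAt h g (x - h) * a 0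
        + ((x - h) / h) • (sumAt h g (x - h) - sumAt h g x) = 0) (s : ℕ) :
    gaugeSeries h (a 0) a g s = 0 := by
  have hev : ∀ᶠ x in rightEnd,
      HasSum (fun s => invFactorial h s x • gaugeSeries h (a 0) a g s) 0 := by
    have h1 : ∀ᶠ x in rightEnd, r + h ≤ x.re := eventually_rightEnd.2 ⟨r + h, fun _ hx => hx⟩
    filter_upwards [heq, h1] with x hx hxr
    rw [← hx]
    exact ha.hasSum_gaugeSeries hh hr hg hxr
  obtain ⟨ρ, hρ, hconv⟩ := exists_absConv hh (hev.mono fun x hx => ⟨0, hx.tendsto_sum_nat⟩)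
  exact hconv.eq_zero hh.le hρ (hev.mono fun x hx => hx.tsum_eq) s

end GaugeEquation

section OperatorK

/-! ### Norms on matrices -/

section AlgebraNorms

variable {n : ℕ}

lemma algebraNorm_le_sum_entries (N : AlgebraNorm ℂ (Mat n)) (M : Mat n) :
    N M ≤ ∑ i, ∑ j, ‖M i j‖ * N (Matrix.single i j 1) := by
  conv_lhs => rw [Matrix.matrix_eq_sum_single M]
  refine (Finset.le_sum_of_subadditive N (map_zero N).le (map_add_le_add N) _ _).trans
    (Finset.sum_le_sum fun i _ => ?_)
  refine (Finset.le_sum_of_subadditive N (map_zero N).le (map_add_le_add N) _ _).trans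
    (Finset.sum_le_sum fun j _ => ?_)
  rw [← map_smul_eq_mul, Matrix.smul_single, smul_eq_mul, mul_one]

/-- Apply submultiplicativity to `M_ij E_ij = E_ii M E_jj`. -/
lemma exists_norm_entry_le (N : AlgebraNorm ℂ (Mat n)) :
    ∃ c, 0 ≤ c ∧ ∀ (M : Mat n) i j, ‖M i j‖ ≤ c * N M := by
  set E : Fin n → Fin n → Mat n := fun i j => Matrix.single i j 1
  have hE : ∀ i j, 0 < N (E i j) := fun i j => by
    refine lt_of_le_of_ne (apply_nonneg N _) fun h0 => ?_
    have h1 := eq_zero_of_map_eq_zero N h0.symm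
    have h2 := congrFun (congrFun h1 i) j
    simp [E] at h2
  have hentry : ∀ (M : Mat n) i j, ‖M i j‖ ≤ N (E i i) * N (E j j) / N (E i j) * N M := by
    intro M i j
    have h1 : M i j • E i j = E i i * M * E j j := by
      simp [E, Matrix.single_mul_mul_single, Matrix.smul_single]
    have h2 : ‖M i j‖ * N (E i j) ≤ N (E i i) * N M * N (E j j) := by
      rw [← map_smul_eq_mul, h1]
      exact (map_mul_le_mul N _ _).trans
        (mul_le_mul_of_nonneg_right (map_mul_le_mul N _ _) (apply_nonneg N _))
    rw [← le_div_iff₀ (hE i j)] at h2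
    exact h2.trans_eq (by ring)
  have hnn : ∀ i j, 0 ≤ N (E i i) * N (E j j) / N (E i j) := fun i j =>
    div_nonneg (mul_nonneg (hE i i).le (hE j j).le) (hE i j).le
  refine ⟨∑ i, ∑ j, N (E i i) * N (E j j) / N (E i j),
    Finset.sum_nonneg fun i _ => Finset.sum_nonneg fun j _ => hnn i j, fun M i j => ?_⟩
  refine (hentry M i j).trans (mul_le_mul_of_nonneg_right ?_ (apply_nonneg N _))
  refine le_trans ?_ (Finset.single_le_sum
    (f := fun i => ∑ j, N (E i i) * N (E j j) / N (E i j))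
    (fun i _ => Finset.sum_nonneg fun j _ => hnn i j) (Finset.mem_univ i))
  exact Finset.single_le_sum (f := fun j => N (E i i) * N (E j j) / N (E i j))
    (fun j _ => hnn i j) (Finset.mem_univ j)

lemma exists_algebraNorm_le (N N' : AlgebraNorm ℂ (Mat n)) :
    ∃ c, 0 ≤ c ∧ ∀ M, N M ≤ c * N' M := by
  obtain ⟨c, hc, hentry⟩ := exists_norm_entry_le N'
  refine ⟨∑ i, ∑ j, c * N (Matrix.single i j (1 : ℂ)), Finset.sum_nonneg fun i _ =>
    Finset.sum_nonneg fun j _ => mul_nonneg hc (apply_nonneg N _), fun M => ?_⟩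
  refine (algebraNorm_le_sum_entries N M).trans ?_
  rw [Finset.sum_mul]
  refine Finset.sum_le_sum fun i _ => ?_
  rw [Finset.sum_mul]
  refine Finset.sum_le_sum fun j _ => ?_
  calc _ ≤ c * N' M * N (Matrix.single i j 1) :=
        mul_le_mul_of_nonneg_right (hentry M i j) (apply_nonneg N _)
    _ = _ := by ring

/-! ### The operators `M ↦ A₀ M - M A₀ ± s M` -/

lemma opK_apply (s : ℕ) (A₀ M : Mat n) : opK s A₀ M = A₀ * M - M * A₀ - (s : ℂ) • M := rfl

/-- A kernel element intertwines: `M (A₀ + s) = A₀ M`. With `χ` the characteristic polynomial of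
`A₀`, Cayley-Hamilton gives `M χ(A₀ + s) = 0`, and non-resonance makes `χ(A₀ + s)` invertible. -/
lemma isUnit_opK {A₀ : Mat n} (hA₀ : IsNonResonant A₀) {s : ℕ} (hs : 1 ≤ s) :
    IsUnit (opK s A₀) := by
  rw [LinearMap.isUnit_iff_ker_eq_bot, LinearMap.ker_eq_bot']
  intro M hM
  rcases Nat.eq_zero_or_pos n with rfl | hn
  · exact Subsingleton.elim _ _
  have : Nonempty (Fin n) := ⟨⟨0, hn⟩⟩
  set B : Mat n := A₀ + algebraMap ℂ (Mat n) s with hB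
  have hsemi : SemiconjBy M B A₀ := by
    rw [opK_apply, sub_sub, sub_eq_zero] at hM
    rw [SemiconjBy, hB, mul_add, hM, ← Algebra.commutes, Algebra.smul_def]
  have hpoly : M * Polynomial.aeval B A₀.charpoly = Polynomial.aeval A₀ A₀.charpoly * M := by
    rw [Polynomial.aeval_eq_sum_range, Polynomial.aeval_eq_sum_range, Finset.mul_sum,
      Finset.sum_mul]
    refine Finset.sum_congr rfl fun k _ => ?_
    rw [mul_smul_comm, smul_mul_assoc, (hsemi.pow_right k).eq]
  rw [Matrix.aeval_self_charpoly, zero_mul] at hpoly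
  have hunit : IsUnit (Polynomial.aeval B A₀.charpoly) := by
    by_contra hnot
    have h0 : (0 : ℂ) ∈ spectrum ℂ (Polynomial.aeval B A₀.charpoly) :=
      (spectrum.zero_mem_iff ℂ).2 hnot
    rw [spectrum.map_polynomial_aeval_of_degree_pos] at h0
    · obtain ⟨μ, hμ, hμ0⟩ := h0
      have h1 : μ ∈ spectrum ℂ A₀ := by
        rw [Matrix.mem_spectrum_iff_isRoot_charpoly]
        exact hμ0
      have h2 : μ - s ∈ spectrum ℂ A₀ := by
        have := (spectrum.add_mem_add_iff (r := μ - s) (s := (s : ℂ)) (a := A₀)).1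
        refine this ?_
        rw [sub_add_cancel, add_comm]
        simpa [hB, add_comm] using hμ
      refine hA₀ μ h1 (μ - s) h2 s (by omega) ?_
      push_cast
      ring
    · rw [Matrix.charpoly_degree_eq_dim, Fintype.card_fin]
      exact_mod_cast hn
  exact (hunit.mul_left_eq_zero).1 hpoly

/-- Trace duality: if `opK s A₀ X = E_ji`, then `M_ij = tr(M E_ji) = -tr((A₀ M - M A₀ + s M) X)`.
The constant `c` depends only on `N` and `n`. -/
lemma exists_le_opK_bound (N : AlgebraNorm ℂ (Mat n)) :
    ∃ c, 0 ≤ c ∧ ∀ (s : ℕ) (A₀ : Mat n) (S : ℝ), 0 ≤ S → IsUnit (opK s A₀) →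
      (∀ M, N (Ring.inverse (opK s A₀) M) ≤ S * N M) →
      ∀ M, N M ≤ c * S * N (A₀ * M - M * A₀ + (s : ℂ) • M) := by
  obtain ⟨c, hc, hentry⟩ := exists_norm_entry_le N
  refine ⟨∑ i, ∑ j, n * c * N (Matrix.single j i (1 : ℂ)) * N (Matrix.single i j (1 : ℂ)),
    Finset.sum_nonneg fun i _ => Finset.sum_nonneg fun j _ => mul_nonneg (mul_nonneg
      (by positivity) (apply_nonneg N _)) (apply_nonneg N _), fun s A₀ S hS hunit hbound M => ?_⟩
  set Y := A₀ * M - M * A₀ + (s : ℂ) • M with hY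
  have htrace : ∀ Z : Mat n, ‖Z.trace‖ ≤ n * c * N Z := fun Z => by
    refine (norm_sum_le _ _).trans ?_
    refine (Finset.sum_le_sum fun i _ => hentry Z i i).trans_eq ?_
    simp [mul_assoc]
  have hM : ∀ i j, ‖M i j‖ ≤ n * c * N (Matrix.single j i (1 : ℂ)) * S * N Y := by
    intro i j
    set X := Ring.inverse (opK s A₀) (Matrix.single j i (1 : ℂ)) with hX
    have h1 : A₀ * X - X * A₀ - (s : ℂ) • X = Matrix.single j i (1 : ℂ) := by
      rw [← opK_apply, hX, ← Module.End.mul_apply, Ring.mul_inverse_cancel _ hunit,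
        Module.End.one_apply]
    have h2 : M i j = -(Y * X).trace := by
      have h3 : M i j = (M * Matrix.single j i (1 : ℂ)).trace := by
        rw [Matrix.trace_mul_single]; simp
      rw [h3, ← h1, hY]
      simp only [mul_sub, sub_mul, add_mul, Matrix.trace_sub, Matrix.trace_add, mul_smul_comm,
        smul_mul_assoc, Matrix.trace_smul]
      rw [← mul_assoc M A₀ X, ← mul_assoc M X A₀, Matrix.trace_mul_comm (M * X) A₀,
        mul_assoc A₀ M X]
      ring
    rw [h2, norm_neg]
    refine (htrace _).trans ?_
    calc _ ≤ n * c * (N Y * (S * N (Matrix.single j i (1 : ℂ)))) := by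
          refine mul_le_mul_of_nonneg_left ((map_mul_le_mul N _ _).trans ?_) (by positivity)
          exact mul_le_mul_of_nonneg_left (hbound _) (apply_nonneg N _)
      _ = _ := by ring
  refine (algebraNorm_le_sum_entries N M).trans ?_
  rw [Finset.sum_mul, Finset.sum_mul]
  refine Finset.sum_le_sum fun i _ => ?_
  rw [Finset.sum_mul, Finset.sum_mul]
  refine Finset.sum_le_sum fun j _ => ?_
  calc _ ≤ _ := mul_le_mul_of_nonneg_right (hM i j) (apply_nonneg N _)
    _ = _ := by ring

lemma le_of_subordNorm_le {N : AlgebraNorm ℂ (Mat n)} {T : Module.End ℂ (Mat n)} {S : ENNReal}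
    (hS : S ≠ ⊤) (hT : subordNorm N T ≤ S) (M : Mat n) : N (T M) ≤ S.toReal * N M := by
  rcases eq_or_ne M 0 with rfl | hM
  · simp
  have hN : 0 < N M := lt_of_le_of_ne (apply_nonneg N _) fun h0 =>
    hM (eq_zero_of_map_eq_zero N h0.symm)
  set c : ℂ := (((N M)⁻¹ : ℝ) : ℂ)
  have hc : ‖c‖ = (N M)⁻¹ := by
    rw [Complex.norm_real, Real.norm_of_nonneg (inv_nonneg.2 hN.le)]
  have h1 : N (c • M) ≤ 1 := by
    rw [map_smul_eq_mul, hc, inv_mul_cancel₀ hN.ne']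
  have h2 : ENNReal.ofReal (N (T (c • M))) ≤ S :=
    (le_iSup₂ (f := fun (M : Mat n) (_ : M ∈ {M : Mat n | N M ≤ 1}) =>
      ENNReal.ofReal (N (T M))) (c • M) h1).trans hT
  rw [ENNReal.ofReal_le_iff_le_toReal hS, map_smul, map_smul_eq_mul, hc, inv_mul_le_iff₀ hN] at h2
  rwa [mul_comm]

end AlgebraNorms

end OperatorK

/-! ### Normalizing gauges, for one system and for a family -/

section NormalizingGauge

variable {n : ℕ}

/-- Multiply on the left by `P`; in use `c = (x - h)/h`, `P = F(x - h)`, `Q = F(x)`. -/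
lemma smul_one_sub_inv_mul_eq_iff {c : ℂ} (hc : c ≠ 0) {P Q A A₀ : Mat n} (hP : IsUnit P) :
    c • (1 - P⁻¹ * (1 - c⁻¹ • A) * Q) = A₀ ↔ A * Q - P * A₀ + c • (P - Q) = 0 := by
  have hdet := (Matrix.isUnit_iff_isUnit_det P).1 hP
  have h1 : P * (c • (1 - P⁻¹ * (1 - c⁻¹ • A) * Q)) = c • (P - Q) + A * Q := by
    rw [mul_smul_comm, mul_sub, mul_one, mul_assoc, Matrix.mul_nonsing_inv_cancel_left _ _ hdet,
      sub_mul, one_mul, smul_mul_assoc, smul_sub, smul_sub, smul_sub, smul_smul, mul_inv_cancel₀ hc,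
      one_smul]
    abel
  rw [← hP.mul_right_inj, h1, ← sub_eq_zero]
  constructor <;> intro h2 <;> rw [← h2] <;> abel

lemma eventually_sub_ne_zero (h : ℝ) : ∀ᶠ x in rightEnd, x - (h : ℂ) ≠ 0 :=
  eventually_rightEnd.2 ⟨h + 1, fun x hx h0 => by
    have := congrArg Complex.re h0
    simp at this
    linarith⟩

lemma eventually_gaugeTransform_iff {h : ℝ} (hh : 0 < h) {A F : ℂ → Mat n} {A₀ : Mat n}
    (hF : ∀ᶠ x in rightEnd, IsUnit (F x)) :
    ∀ᶠ x in rightEnd, gaugeTransform h A F x = A₀ ↔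
      A x * F x - F (x - h) * A₀ + ((x - h) / h) • (F (x - h) - F x) = 0 := by
  have hhc : (h : ℂ) ≠ 0 := by exact_mod_cast hh.ne'
  filter_upwards [(tendsto_sub_rightEnd h).eventually hF, eventually_sub_ne_zero h] with x hx hx0
  rw [← smul_one_sub_inv_mul_eq_iff (div_ne_zero hx0 hhc) hx, inv_div, gaugeTransform]

section LinftyOpNorm

attribute [local instance] Matrix.linftyOpNormedRing Matrix.linftyOpNormedAlgebra

/-- The operator norm on matrices attached to the supremum norm on vectors. -/
def linftyAlgebraNorm (n : ℕ) : AlgebraNorm ℂ (Mat n) where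
  toFun := norm
  map_zero' := norm_zero
  add_le' := norm_add_le
  neg' := norm_neg
  mul_le' := norm_mul_le
  eq_zero_of_map_eq_zero' _ := norm_eq_zero.1
  smul' := norm_smul

lemma AbsConv.hasFactorialExpansion {h r : ℝ} (hh : 0 < h) (hr : 0 < r) {a : ℕ → Mat n}
    (ha : AbsConv h r a) : HasFactorialExpansion h (sumAt h a) a :=
  eventually_rightEnd.2 ⟨r, fun _ hx => (ha.hasSum hh.le hr hx).tendsto_sum_nat⟩

lemma HasFactorialExpansion.exists_absConv {h : ℝ} (hh : 0 < h) {F : ℂ → Mat n} {a : ℕ → Mat n}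
    (hF : HasFactorialExpansion h F a) :
    ∃ r, 0 < r ∧ AbsConv h r a ∧ F =ᶠ[rightEnd] sumAt h a := by
  obtain ⟨r, hr, ha⟩ := FuchsConfluence.exists_absConv hh (hF.mono fun x hx => ⟨F x, hx⟩)
  refine ⟨r, hr, ha, ?_⟩
  filter_upwards [hF, ha.hasFactorialExpansion hh hr] with x h1 h2
  exact tendsto_nhds_unique h1 h2

lemma HasFactorialExpansion.eq_of_hasValueAtInfty {h : ℝ} (hh : 0 < h) {F : ℂ → Mat n}
    {a : ℕ → Mat n} (hF : HasFactorialExpansion h F a) {M : Mat n} (hM : HasValueAtInfty F M) :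
    a 0 = M := by
  obtain ⟨r, hr, ha, hFa⟩ := hF.exists_absConv hh
  exact tendsto_nhds_unique (ha.tendsto_sumAt hh.le hr) (Tendsto.congr' hFa hM)

lemma isNormalizingGauge_sumAt {h r : ℝ} (hh : 0 < h) (hr : 0 < r) {A : ℂ → Mat n}
    {a f : ℕ → Mat n} (ha : HasFactorialExpansion h A a) (hf : AbsConv h r f) (hf0 : f 0 = 1)
    (hgauge : ∀ s, gaugeSeries h (a 0) a f s = 0) :
    IsNormalizingGauge h A (a 0) (sumAt h f) := by
  obtain ⟨r₁, hr₁, ha₁, hAa⟩ := ha.exists_absConv hh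
  obtain ⟨r₂, hr₂, g, hg, hfg⟩ := hf.exists_inverse hh hr hf0
  have hinv : ∀ᶠ x in rightEnd, sumAt h f x * sumAt h g x = 1 ∧ sumAt h g x * sumAt h f x = 1 :=
    eventually_rightEnd.2 ⟨r₂, fun x hx => ⟨hfg x hx, mul_eq_one_comm.1 (hfg x hx)⟩⟩
  refine ⟨⟨⟨f, hf.hasFactorialExpansion hh hr⟩, sumAt h g, ⟨g, hg.hasFactorialExpansion hh hr₂⟩,
    hinv⟩, ?_, ?_⟩
  · have := hf.tendsto_sumAt hh.le hr
    rwa [hf0] at this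
  · have hunit : ∀ᶠ x in rightEnd, IsUnit (sumAt h f x) := hinv.mono fun x hx =>
      ⟨⟨_, _, hx.1, hx.2⟩, rfl⟩
    have hlarge : ∀ᶠ x in rightEnd, max r r₁ + h ≤ x.re :=
      eventually_rightEnd.2 ⟨_, fun _ hx => hx⟩
    filter_upwards [eventually_gaugeTransform_iff (A := A) (A₀ := a 0) hh hunit, hAa, hlarge]
      with x hx hAx hlx
    rw [hx, hAx]
    have hsum := (ha₁.mono hh.le hr₁ (le_max_right r r₁)).hasSum_gaugeSeries hh
      (hr.trans_le (le_max_left _ _)) (hf.mono hh.le hr (le_max_left r r₁)) hlx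
    simp only [hgauge, smul_zero] at hsum
    exact hsum.unique hasSum_zero

lemma IsNormalizingGauge.exists_coeffs {h : ℝ} (hh : 0 < h) {A G : ℂ → Mat n} {a : ℕ → Mat n}
    (ha : HasFactorialExpansion h A a) (hG : IsNormalizingGauge h A (a 0) G) :
    ∃ g, HasFactorialExpansion h G g ∧ g 0 = 1 ∧ ∀ s, gaugeSeries h (a 0) a g s = 0 := by
  obtain ⟨⟨⟨g, hg⟩, G', -, hinv⟩, hlim, hgauge⟩ := hG
  obtain ⟨r₁, hr₁, ha₁, hAa⟩ := ha.exists_absConv hh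
  obtain ⟨r, hr, hg₁, hGg⟩ := hg.exists_absConv hh
  refine ⟨g, hg, hg.eq_of_hasValueAtInfty hh hlim,
    (ha₁.mono hh.le hr₁ (le_max_right r r₁)).gaugeSeries_eq_zero hh
      (hr.trans_le (le_max_left _ _)) (hg₁.mono hh.le hr (le_max_left r r₁)) ?_⟩
  have hunit : ∀ᶠ x in rightEnd, IsUnit (G x) := hinv.mono fun x hx => ⟨⟨_, _, hx.1, hx.2⟩, rfl⟩
  filter_upwards [eventually_gaugeTransform_iff (A := A) (A₀ := a 0) hh hunit, hAa, hgauge, hGg,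
    (tendsto_sub_rightEnd h).eventually hGg] with x hx hAx hgx hGx hGx'
  rw [← hAx, ← hGx, ← hGx', ← hx]
  exact hgx

lemma exists_inverse_opK_neg {κ : ℝ} {A₀ : Mat n}
    (hκ : ∀ s : ℕ, 1 ≤ s → ∀ M : Mat n, s * ‖M‖ ≤ κ * ‖A₀ * M - M * A₀ + (s : ℂ) • M‖) :
    ∃ L : ℕ → Mat n → Mat n, ∀ s, 1 ≤ s → ∀ y z,
      L s y = z ↔ A₀ * z - z * A₀ + (s : ℂ) • z = y := by
  set T : ℕ → Module.End ℂ (Mat n) := fun s =>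
    LinearMap.mulLeft ℂ A₀ - LinearMap.mulRight ℂ A₀ + (s : ℂ) • (1 : Module.End ℂ (Mat n))
  have hT : ∀ s M, T s M = A₀ * M - M * A₀ + (s : ℂ) • M := fun s M => rfl
  have hinj : ∀ s, 1 ≤ s → Function.Injective (T s) := fun s hs => by
    rw [injective_iff_map_eq_zero]
    intro M hM
    have h1 := hκ s hs M
    rw [← hT, hM, norm_zero, mul_zero] at h1
    have hs' : (0 : ℝ) < s := by exact_mod_cast hs
    exact norm_le_zero_iff.1 (nonpos_of_mul_nonpos_right h1 hs')
  refine ⟨fun s => Function.invFun (T s), fun s hs y z => ?_⟩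
  rw [← hT]
  constructor
  · rintro rfl
    exact Function.rightInverse_invFun (LinearMap.surjective_of_injective (hinj s hs)) y
  · rintro rfl
    exact Function.leftInverse_invFun (hinj s hs) z

/-- Existence for one `h` uses a radius depending on `h`. The last clause leaves `r` free so that a
common radius can be inserted later. -/
lemma exists_normalizing_coeffs {h κ : ℝ} (hh : 0 < h) (hκ0 : 0 ≤ κ) {A : ℂ → Mat n}
    {a : ℕ → Mat n} (ha : HasFactorialExpansion h A a)
    (hκ : ∀ s : ℕ, 1 ≤ s → ∀ M : Mat n, s * ‖M‖ ≤ κ * ‖a 0 * M - M * a 0 + (s : ℂ) • M‖) :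
    ∃ f, f 0 = 1 ∧ IsNormalizingGauge h A (a 0) (sumAt h f) ∧
      (∀ G, IsNormalizingGauge h A (a 0) G → HasFactorialExpansion h G f) ∧
      ∀ r, h < r → AbsConv h r a →
        κ * (‖a 0‖ * (h / (r - h)) + absSum h r (tailSeries a)) ≤ 1 / 2 →
        ∀ s, ‖f s‖ ≤ 2 * ‖(1 : Mat n)‖ * risingFactorial h s r := by
  obtain ⟨L, hL⟩ := exists_inverse_opK_neg hκ
  have hLbound : ∀ s : ℕ, 1 ≤ s → ∀ y, s * ‖L s y‖ ≤ κ * ‖y‖ := fun s hs y => by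
    have := hκ s hs (L s y)
    rwa [(hL s hs y _).1 rfl] at this
  obtain ⟨f, hf⟩ := exists_causal_fixedPoint
    (gaugeMap_causal (h := h) (a₀ := a 0) (a := a) (L := L))
  obtain ⟨hf0, hfg⟩ := (eq_gaugeMap_iff hL).1 hf
  have hbound : ∀ r, h < r → AbsConv h r a →
      κ * (‖a 0‖ * (h / (r - h)) + absSum h r (tailSeries a)) ≤ 1 / 2 →
      AbsConv h r f ∧ absSum h r f ≤ 2 * ‖(1 : Mat n)‖ := fun r hr har hq => by
    have := AbsConv.of_eq_gaugeMap hh hr hκ0 hLbound har hq (by norm_num) hf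
    refine ⟨this.1, this.2.trans_eq ?_⟩
    ring
  refine ⟨f, hf0, ?_, fun G hG => ?_, fun r hr har hq s => ?_⟩
  · obtain ⟨r₁, hr₁, ha₁, -⟩ := ha.exists_absConv hh
    -- This `ε` and the `D` below each contribute at most `1/4` to the contraction constant.
    obtain ⟨ρ, hρ⟩ := exists_absSum_tailSeries_le hh.le hr₁ (ε := 1 / (4 * (κ + 1)))
      (by positivity) ha₁
    set D := 4 * (κ * ‖a 0‖ * h) + 1 with hD
    have hD1 : 0 < D := by positivity
    set r := max ρ (h + D) with hr
    have hrD : D ≤ r - h := by linarith [le_max_right ρ (h + D)]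
    obtain ⟨har, hle⟩ := hρ r (le_max_left _ _)
    refine isNormalizingGauge_sumAt hh (r := r) (by linarith) ha
      (hbound r (by linarith) har ?_).1 hf0 hfg
    have h1 : κ * (‖a 0‖ * (h / (r - h))) ≤ 1 / 4 := by
      have h2 : κ * (‖a 0‖ * (h / (r - h))) = κ * ‖a 0‖ * h / (r - h) := by ring
      rw [h2, div_le_iff₀ (by linarith)]
      linarith
    have h3 : κ * absSum h r (tailSeries a) ≤ 1 / 4 := by
      calc _ ≤ κ * (1 / (4 * (κ + 1))) := mul_le_mul_of_nonneg_left hle hκ0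
        _ ≤ 1 / 4 := by
          rw [mul_one_div, div_le_div_iff₀ (by positivity) (by norm_num)]
          linarith
    rw [mul_add]
    linarith
  · obtain ⟨g, hg, hg0, hgg⟩ := hG.exists_coeffs hh ha
    have := causal_fixedPoint_unique gaugeMap_causal hf ((eq_gaugeMap_iff hL).2 ⟨hg0, hgg⟩)
    rwa [this]
  · obtain ⟨h1, h2⟩ := hbound r hr har hq
    have hpos := risingFactorial_pos hh.le (hh.trans hr) s
    have h3 : (risingFactorial h s r)⁻¹ * ‖f s‖ ≤ absSum h r f :=
      h1.le_tsum s fun j _ => mul_nonneg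
        (inv_nonneg.2 (risingFactorial_pos hh.le (hh.trans hr) j).le) (norm_nonneg _)
    rw [inv_mul_le_iff₀ hpos] at h3
    calc _ ≤ _ := h3
      _ ≤ risingFactorial h s r * (2 * ‖(1 : Mat n)‖) := mul_le_mul_of_nonneg_left h2 hpos.le
      _ = _ := mul_comm _ _

/-- For `s ≥ 4 B` the commutator has norm at most `2 B ‖M‖ ≤ s ‖M‖ / 2` and is absorbed; for `s ≤ 4
B` the bound on the inverse suffices. -/
lemma mul_norm_le_of_bound {κ B : ℝ} (hB : 0 ≤ B) {A₀ : Mat n} (hA₀ : ‖A₀‖ ≤ B)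
    (hκ : ∀ s : ℕ, 1 ≤ s → ∀ M : Mat n, ‖M‖ ≤ κ * ‖A₀ * M - M * A₀ + (s : ℂ) • M‖) (s : ℕ)
    (hs : 1 ≤ s) (M : Mat n) :
    s * ‖M‖ ≤ max 2 (4 * B * κ) * ‖A₀ * M - M * A₀ + (s : ℂ) • M‖ := by
  set Y := A₀ * M - M * A₀ + (s : ℂ) • M with hY
  rcases le_total (4 * B) s with h4 | h4
  · have h1 : (s : ℂ) • M = Y - (A₀ * M - M * A₀) := by rw [hY]; abel
    have h2 : s * ‖M‖ ≤ ‖Y‖ + (B * ‖M‖ + ‖M‖ * B) := by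
      calc (s : ℝ) * ‖M‖ = ‖(s : ℂ) • M‖ := by rw [norm_smul, Complex.norm_natCast]
        _ ≤ ‖Y‖ + ‖A₀ * M - M * A₀‖ := by rw [h1]; exact norm_sub_le _ _
        _ ≤ _ := by
          refine add_le_add_right ((norm_sub_le _ _).trans (add_le_add ?_ ?_)) _
          · exact (norm_mul_le _ _).trans (mul_le_mul_of_nonneg_right hA₀ (norm_nonneg _))
          · exact (norm_mul_le _ _).trans (mul_le_mul_of_nonneg_left hA₀ (norm_nonneg _))
    have h3 : 4 * B * ‖M‖ ≤ s * ‖M‖ := mul_le_mul_of_nonneg_right h4 (norm_nonneg _)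
    calc (s : ℝ) * ‖M‖ ≤ 2 * ‖Y‖ := by linarith
      _ ≤ _ := mul_le_mul_of_nonneg_right (le_max_left _ _) (norm_nonneg _)
  · calc (s : ℝ) * ‖M‖ ≤ 4 * B * (κ * ‖Y‖) :=
          mul_le_mul h4 (hκ s hs M) (norm_nonneg _) (by positivity)
      _ = 4 * B * κ * ‖Y‖ := by ring
      _ ≤ _ := mul_le_mul_of_nonneg_right (le_max_right _ _) (norm_nonneg _)

/-- With `r = h₀ + lam + D`, both `r - h` and `r - lam` are at least `D`, so the constant is at most
`κ (B h₀ + C) / D`. -/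
lemma gauge_radius_bound {h h₀ lam κ B C D : ℝ} (hh : 0 < h) (hh₀ : h < h₀) (hlam : 0 ≤ lam)
    (hκ : 0 ≤ κ) (hC : 0 ≤ C) (hD : D = 2 * κ * (B * h₀ + C) + 1) (hD0 : 0 < D)
    {a : ℕ → Mat n} (hB : ‖a 0‖ ≤ B)
    (ha : ∀ s, ‖a (s + 1)‖ ≤ C * risingFactorial h s lam) :
    AbsConv h (h₀ + lam + D) a ∧
      κ * (‖a 0‖ * (h / (h₀ + lam + D - h)) + absSum h (h₀ + lam + D) (tailSeries a)) ≤ 1 / 2 := by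
  obtain ⟨h1, h2⟩ := absConv_of_norm_le_risingFactorial hh hlam (r := h₀ + lam + D)
    (by linarith) ha
  refine ⟨h1, ?_⟩
  have hB0 := (norm_nonneg _).trans hB
  have h3 : ‖a 0‖ * (h / (h₀ + lam + D - h)) ≤ B * (h₀ / D) := by
    refine mul_le_mul hB ?_ (div_nonneg hh.le (by linarith)) hB0
    exact div_le_div₀ (by linarith) hh₀.le hD0 (by linarith)
  have h4 : absSum h (h₀ + lam + D) (tailSeries a) ≤ C / D :=
    h2.trans (div_le_div_of_nonneg_left hC hD0 (by linarith))
  calc _ ≤ κ * (B * (h₀ / D) + C / D) := mul_le_mul_of_nonneg_left (add_le_add h3 h4) hκ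
    _ = κ * (B * h₀ + C) / D := by ring
    _ ≤ 1 / 2 := by
      rw [div_le_div_iff₀ hD0 (by norm_num)]
      linarith

theorem exists_uniform_normalizing_coeffs {h₀ h₁ C lam B κ : ℝ}
    (hlam : 0 ≤ lam) (hC : 0 ≤ C) (hB0 : 0 ≤ B) {A : ℝ → ℂ → Mat n}
    {a : ℝ → ℕ → Mat n} (ha : ∀ h ∈ Ioo 0 h₀, HasFactorialExpansion h (A h) (a h))
    (hh₁ : h₁ ∈ Ioo 0 h₀)
    (hbound : ∀ h ∈ Ioo 0 h₁, ∀ s, linftyAlgebraNorm n (a h (s + 1)) ≤ C * risingFactorial h s lam)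
    (hB : ∀ h ∈ Ioo 0 h₀, linftyAlgebraNorm n (a h 0) ≤ B)
    (hκ : ∀ h ∈ Ioo 0 h₀, ∀ s : ℕ, 1 ≤ s → ∀ M : Mat n,
      linftyAlgebraNorm n M ≤
        κ * linftyAlgebraNorm n (a h 0 * M - M * a h 0 + (s : ℂ) • M)) :
    ∃ C' lam' : ℝ, 0 ≤ C' ∧ 0 ≤ lam' ∧ ∃ f : ℝ → ℕ → Mat n,
      (∀ h ∈ Ioo 0 h₀, f h 0 = 1 ∧ IsNormalizingGauge h (A h) (a h 0) (sumAt h (f h)) ∧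
        ∀ G, IsNormalizingGauge h (A h) (a h 0) G → HasFactorialExpansion h G (f h)) ∧
      ∀ h ∈ Ioo 0 h₁, ∀ s, linftyAlgebraNorm n (f h (s + 1)) ≤ C' * risingFactorial h s lam' := by
  set κ' := max 2 (4 * B * κ)
  have hκ'0 : 0 ≤ κ' := le_trans (by norm_num) (le_max_left _ _)
  have hh₀ : 0 < h₀ := hh₁.1.trans hh₁.2
  set D := 2 * κ' * (B * h₀ + C) + 1 with hD
  have hD0 : 0 < D := by positivity
  set r := h₀ + lam + D with hr
  have hr0 : 0 < r := by positivity
  have key : ∀ h ∈ Ioo 0 h₀, _ := fun h hh => exists_normalizing_coeffs hh.1 hκ'0 (ha h hh)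
    (mul_norm_le_of_bound hB0 (hB h hh) (hκ h hh))
  choose! f hf0 hf hfG hfb using key
  -- These witnesses come from `r^{[s+1]} = r (r + h)^{[s]} ≤ r (r + h₀)^{[s]}`.
  refine ⟨2 * ‖(1 : Mat n)‖ * r, r + h₀, by positivity, by positivity, f,
    fun h hh => ⟨hf0 h hh, hf h hh, hfG h hh⟩, fun h hh s => ?_⟩
  have hh' : h ∈ Ioo 0 h₀ := ⟨hh.1, hh.2.trans hh₁.2⟩
  obtain ⟨h1, h2⟩ := gauge_radius_bound hh.1 hh'.2 hlam hκ'0 hC hD hD0 (hB h hh') (hbound h hh)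
  refine (hfb h hh' r (by linarith [hh'.2]) h1 h2 (s + 1)).trans ?_
  rw [risingFactorial_succ', ← mul_assoc]
  refine mul_le_mul_of_nonneg_left ?_ (by positivity)
  exact risingFactorial_mono hh.1.le (by linarith [hh.1]) (by linarith [hh'.2]) s

end LinftyOpNorm

end NormalizingGauge

end FuchsConfluence

end

/-! ### Transfer to an arbitrary algebra norm -/

theorem mainTheorem5 {n : ℕ} (N : AlgebraNorm ℂ (FuchsConfluence.Mat n))
    (h₀ C lam : ℝ) (hh₀ : 0 < h₀)
    (A : ℝ → ℂ → FuchsConfluence.Mat n) (A₀ : ℝ → FuchsConfluence.Mat n)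
    (hA : FuchsConfluence.IsFuchsian N h₀ C lam A)
    (hA₀ : ∀ h ∈ Set.Ioo 0 h₀, FuchsConfluence.HasValueAtInfty (A h) (A₀ h))
    (hres : ∀ h ∈ Set.Ioo 0 h₀, FuchsConfluence.IsNonResonant (A₀ h))
    (hK : (⨆ s ∈ Set.Ici (1 : ℕ), ⨆ h ∈ Set.Ioo 0 h₀,
      FuchsConfluence.subordNorm N (Ring.inverse (FuchsConfluence.opK s (A₀ h)))) < ⊤) :
    (∀ h ∈ Set.Ioo 0 h₀, ∃ F : ℂ → FuchsConfluence.Mat n,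
      FuchsConfluence.IsNormalizingGauge h (A h) (A₀ h) F ∧
      ∀ G : ℂ → FuchsConfluence.Mat n, FuchsConfluence.IsNormalizingGauge h (A h) (A₀ h) G →
        G =ᶠ[FuchsConfluence.rightEnd] F) ∧
    (∀ F : ℝ → ℂ → FuchsConfluence.Mat n,
      (∀ h ∈ Set.Ioo 0 h₀, FuchsConfluence.IsNormalizingGauge h (A h) (A₀ h) (F h)) →
      ∃ C' lam' : ℝ, FuchsConfluence.IsOfType N h₀ C' lam' F) := by
  obtain ⟨-, hC, hlam, a, ha, ⟨h₁, hh₁, hbound⟩, B, hB⟩ := hA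
  have ha0 : ∀ h ∈ Set.Ioo 0 h₀, a h 0 = A₀ h := fun h hh =>
    (ha h hh).eq_of_hasValueAtInfty hh.1 (hA₀ h hh)
  obtain ⟨c₁, hc₁, hle₁⟩ :=
    FuchsConfluence.exists_algebraNorm_le (FuchsConfluence.linftyAlgebraNorm n) N
  obtain ⟨c₂, hc₂, hle₂⟩ :=
    FuchsConfluence.exists_algebraNorm_le N (FuchsConfluence.linftyAlgebraNorm n)
  obtain ⟨c₃, hc₃, hinv⟩ := FuchsConfluence.exists_le_opK_bound N
  set S := ⨆ s ∈ Set.Ici (1 : ℕ), ⨆ h ∈ Set.Ioo 0 h₀,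
      FuchsConfluence.subordNorm N (Ring.inverse (FuchsConfluence.opK s (A₀ h))) with hS
  have hsub : ∀ h ∈ Set.Ioo 0 h₀, ∀ s : ℕ, 1 ≤ s →
      FuchsConfluence.subordNorm N (Ring.inverse (FuchsConfluence.opK s (A₀ h))) ≤ S :=
    fun h hh s hs => (le_iSup₂ (f := fun (h : ℝ) (_ : h ∈ Set.Ioo 0 h₀) =>
      FuchsConfluence.subordNorm N (Ring.inverse (FuchsConfluence.opK s (A₀ h)))) h hh).trans
      (le_iSup₂ (f := fun (s : ℕ) (_ : s ∈ Set.Ici (1 : ℕ)) => ⨆ h ∈ Set.Ioo 0 h₀,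
        FuchsConfluence.subordNorm N (Ring.inverse (FuchsConfluence.opK s (A₀ h)))) s hs)
  have hκ : ∀ h ∈ Set.Ioo 0 h₀, ∀ s : ℕ, 1 ≤ s → ∀ M : FuchsConfluence.Mat n,
      FuchsConfluence.linftyAlgebraNorm n M ≤ c₁ * (c₃ * S.toReal * c₂) *
        FuchsConfluence.linftyAlgebraNorm n (a h 0 * M - M * a h 0 + (s : ℂ) • M) := by
    intro h hh s hs M
    rw [ha0 h hh]
    -- `Ring.inverse` is `0` on non-units, so `hK` controls a genuine inverse only thanks to
    -- non-resonance.
    have h1 := hinv s (A₀ h) S.toReal ENNReal.toReal_nonneg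
      (FuchsConfluence.isUnit_opK (hres h hh) hs)
      (FuchsConfluence.le_of_subordNorm_le hK.ne (hsub h hh s hs)) M
    calc _ ≤ c₁ * N M := hle₁ M
      _ ≤ c₁ * (c₃ * S.toReal * (c₂ * FuchsConfluence.linftyAlgebraNorm n
            (A₀ h * M - M * A₀ h + (s : ℂ) • M))) := by
          refine mul_le_mul_of_nonneg_left (h1.trans ?_) hc₁
          exact mul_le_mul_of_nonneg_left (hle₂ _) (by positivity)
      _ = _ := by ring
  have hB0 : 0 ≤ B := by
    have hmid : h₀ / 2 ∈ Set.Ioo 0 h₀ := ⟨by linarith, by linarith⟩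
    exact (apply_nonneg N _).trans (hB _ hmid)
  obtain ⟨C', lam', hC', hlam', f, hf, hfb⟩ :=
    FuchsConfluence.exists_uniform_normalizing_coeffs hlam (mul_nonneg hc₁ hC)
      (mul_nonneg hc₁ hB0) ha hh₁ (fun h hh s => by
        have h1 := hbound h hh (s + 1) (by omega)
        rw [Nat.add_sub_cancel] at h1
        calc _ ≤ c₁ * N (a h (s + 1)) := hle₁ _
          _ ≤ c₁ * (C * FuchsConfluence.risingFactorial h s lam) :=
            mul_le_mul_of_nonneg_left h1 hc₁
          _ = _ := by ring)
      (fun h hh => (hle₁ _).trans (mul_le_mul_of_nonneg_left (hB h hh) hc₁)) hκ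
  refine ⟨fun h hh => ?_, fun F hF => ⟨c₂ * C', lam', mul_nonneg hc₂ hC', hlam', f, fun h hh => ?_,
    ⟨h₁, hh₁, fun h hh s hs => ?_⟩, N 1, fun h hh => ?_⟩⟩
  · obtain ⟨-, hgauge, hunique⟩ := hf h hh
    rw [ha0 h hh] at hgauge hunique
    refine ⟨_, hgauge, fun G hG => ?_⟩
    filter_upwards [hunique G hG, hunique _ hgauge] with x h1 h2
    exact tendsto_nhds_unique h1 h2
  · have h1 := hF h hh
    rw [← ha0 h hh] at h1
    exact (hf h hh).2.2 _ h1
  · obtain ⟨k, rfl⟩ : ∃ k, s = k + 1 := ⟨s - 1, by omega⟩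
    rw [Nat.add_sub_cancel]
    calc _ ≤ c₂ * FuchsConfluence.linftyAlgebraNorm n (f h (k + 1)) := hle₂ _
      _ ≤ c₂ * (C' * FuchsConfluence.risingFactorial h k lam') :=
        mul_le_mul_of_nonneg_left (hfb h hh k) hc₂
      _ = _ := by ring
  · rw [(hf h hh).1]
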